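/- Let $\Omega\subset\mathbb{C}$ be a bounded domain (nonempty, open and connected) that is finitely connected, i.e. its complement has finitely many connected components, and suppose that no component of the complement is a single point (this holds, for example, whenever $\partial\Omega$ is a finite union of pairwise disjoint Jordan curves). Let $A^2(\Omega)$ be the Bergman space of functions $f$ holomorphic in $\Omega$ with $\int_\Omega |f|^2\,dA<\infty$, and let $f\in A^2(\Omega)$ be the best approximation to $\bar z$ in $A^2(\Omega)$, i.e. $\|\bar z-f\|_{L^2(\Omega)}\le\|\bar z-g\|_{L^2(\Omega)}$ for all $g\in A^2(\Omega)$. If $f$ is (the restriction to $\Omega$ of) a polynomial in $z$, then $\Omega$ is simply connected and $\partial\Omega$ is algebraic, i.e. there is a nonzero real polynomial $Q(x,y)$ that vanishes at every point $x+iy\in\partial\Omega$. -/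

import Mathlib

open MeasureTheory Polynomial
open scoped ENNReal ComplexConjugate

/-- The Bergman space `A²(Ω)`: functions holomorphic in `Ω` and square integrable over `Ω` with
respect to area. (Only the values on `Ω` matter.) -/
def bergmanSpace (Ω : Set ℂ) : Set (ℂ → ℂ) :=
  {f | DifferentiableOn ℂ f Ω ∧ MemLp f 2 (volume.restrict Ω)}

/-- `f` is a best approximation to `h` in `A²(Ω)`: it belongs to `A²(Ω)` and minimizes the
`L²(Ω)`-distance to `h` among all elements of `A²(Ω)`. -/
def IsBestBergmanApprox (Ω : Set ℂ) (h f : ℂ → ℂ) : Prop :=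
  f ∈ bergmanSpace Ω ∧
    ∀ g ∈ bergmanSpace Ω,
      eLpNorm (fun z => h z - f z) 2 (volume.restrict Ω) ≤
        eLpNorm (fun z => h z - g z) 2 (volume.restrict Ω)

/-- The connected components of the complement of `Ω` in the plane. For bounded `Ω` they correspond
one to one to the components of the complement in the Riemann sphere: exactly one of them is
unbounded, and it receives the point at infinity. -/
def complementComponents (Ω : Set ℂ) : Set (Set ℂ) :=
  {K | ∃ z ∈ Ωᶜ, K = connectedComponentIn Ωᶜ z}

/-- A planar set is algebraic if it lies on a real algebraic curve `Q(x, y) = 0`, where `Q` is a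
real polynomial in two variables that is not identically zero. -/
def IsAlgebraicPlaneSet (S : Set ℂ) : Prop :=
  ∃ Q : MvPolynomial (Fin 2) ℝ, Q ≠ 0 ∧ ∀ z ∈ S, MvPolynomial.eval ![z.re, z.im] Q = 0

/-!
Let `P' = p`, `q(z) = z - conj (p z)`, and let `φ(ζ) = ∫_Ω q(z) / (z - ζ) dA(z)` be the
(unnormalized) Cauchy transform of `q`. That `p` is the best approximation to `conj z` says that
`q`, multiplied by any `g` in the Bergman space, integrates to `0`.

*Vanishing off `Ω`.* For a boundary point `a` the kernel `1 / (z - a)` is not square integrable,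
but since the component `K` of `a` in the complement is not a point, it is an `L¹`-limit of elements
of the Bergman space: choose `b` close to `a` such that `a` and `b` can be joined by arbitrarily
fine chains in the complement close to `a`, and take a branch of `1 / √((z - a) (z - b))`. Hence
`φ = 0` off `Ω` (`cauchyTransform_eq_zero_of_orthogonal`).

*Inside `Ω`*, `∂̄φ = -π q`, so that `φ / π + |z|² - conj P` is holomorphic
(`differentiableOn_cauchyTransform_add`), and it is continuous in the whole plane
(`continuous_cauchyTransform`). Subtracting `P` gives a function that is holomorphic in `Ω`,
continuous up to the boundary, and equal to the real number `|z|² - 2 Re P` on the boundary. By the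
maximum principle it is a real constant `c`. So `∂Ω` lies on the curve `|z|² - 2 Re P = c`
(`exists_quadraticPotential_eq_zero_on_frontier`).

*No holes.* The function `w = |z|² - 2 Re P - c` is strictly subharmonic in the whole plane, and it
vanishes on `∂Ω`. Hence `w < 0` in `Ω`, and also in each bounded open `V` with `∂V ⊆ Ω`, so that `V`
does not meet `∂Ω` and is contained in `Ω` (`subset_of_frontier_subset`). Such an open connected set
is simply connected (`isSimplyConnected_of_frontier_subset`): a loop is homotopic to a walk along
the edges of a fine square grid, and a closed grid walk without repeated vertices is contracted by
pushing its top left corner across the adjacent cell, which is enclosed by the walk and hence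
contained in `Ω` (`walkProd_eq_one`).
-/

/-! ### Closed lattice walks -/

section LatticeWalks

variable {α G : Type*}

/-- The product of the labels `τ` of the successive steps of the walk from `v` to `w` whose
intermediate vertices are listed in `L`. -/
def walkProd [Mul G] (τ : α → α → G) : α → List α → α → G
  | v, [], w => τ v w
  | v, x :: L, w => τ v x * walkProd τ x L w

/-- The sum modulo `2` of the labels of the steps of a walk; used for counting crossings. -/
def walkSum (c : α → α → ZMod 2) : α → List α → α → ZMod 2
  | v, [], w => c v w
  | v, x :: L, w => c v x + walkSum c x L w

/-- All steps of the walk from `v` through the vertices of `L` to `w` satisfy `E`. -/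
def IsWalk (E : α → α → Prop) : α → List α → α → Prop
  | v, [], w => E v w
  | v, x :: L, w => E v x ∧ IsWalk E x L w

theorem walkProd_append [Semigroup G] (τ : α → α → G) (v x w : α) (L₁ L₂ : List α) :
    walkProd τ v (L₁ ++ x :: L₂) w = walkProd τ v L₁ x * walkProd τ x L₂ w := by
  induction L₁ generalizing v with
  | nil => rfl
  | cons y L ih => simp [walkProd, ih, mul_assoc]

theorem walkSum_append (c : α → α → ZMod 2) (v x w : α) (L₁ L₂ : List α) :
    walkSum c v (L₁ ++ x :: L₂) w = walkSum c v L₁ x + walkSum c x L₂ w := by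
  induction L₁ generalizing v with
  | nil => rfl
  | cons y L ih => simp [walkSum, ih, add_assoc]

theorem isWalk_append (E : α → α → Prop) (v x w : α) (L₁ L₂ : List α) :
    IsWalk E v (L₁ ++ x :: L₂) w ↔ IsWalk E v L₁ x ∧ IsWalk E x L₂ w := by
  induction L₁ generalizing v with
  | nil => rfl
  | cons y L ih => simp [IsWalk, ih, and_assoc]

/-- The steps of a walk run between its vertices. -/
theorem IsWalk.restrict {E : α → α → Prop} {S : α → Prop} {v w : α} {L : List α}
    (hw : IsWalk E v L w) (hv : S v) (hw' : S w) (hL : ∀ x ∈ L, S x) :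
    IsWalk (fun u u' => E u u' ∧ S u ∧ S u') v L w := by
  induction L generalizing v with
  | nil => exact ⟨hw, hv, hw'⟩
  | cons y L ih =>
    exact ⟨⟨hw.1, hv, hL y (by simp)⟩, ih hw.2 (hL y (by simp)) fun x hx => hL x (by simp [hx])⟩

/-- If the label of each step is the increment of a function, the sum telescopes. -/
theorem IsWalk.walkSum_eq_sub {E : α → α → Prop} {c : α → α → ZMod 2} {g : α → ZMod 2}
    (h : ∀ u v, E u v → c u v = g v - g u) {v w : α} {L : List α} (hw : IsWalk E v L w) :
    walkSum c v L w = g w - g v := by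
  induction L generalizing v with
  | nil => exact h _ _ hw
  | cons y L ih => rw [walkSum, h _ _ hw.1, ih hw.2]; ring

theorem IsWalk.exists_step_of_walkSum_ne_zero {E : α → α → Prop} {c : α → α → ZMod 2}
    {v w : α} {L : List α} (hw : IsWalk E v L w) (h : walkSum c v L w ≠ 0) :
    ∃ u u', E u u' ∧ c u u' ≠ 0 := by
  by_contra! hc
  exact h (by simpa using hw.walkSum_eq_sub (g := 0) (fun u u' hu => by simp [hc u u' hu]))

theorem walkSum_add (c c' : α → α → ZMod 2) (v w : α) (L : List α) :
    walkSum (fun u u' => c u u' + c' u u') v L w = walkSum c v L w + walkSum c' v L w := by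
  induction L generalizing v with
  | nil => rfl
  | cons y L ih => simp [walkSum, ih]; ring

/-- Adjacency in the square lattice `ℤ²`. -/
def LatticeAdj (u v : ℤ × ℤ) : Prop :=
  (u.1 = v.1 ∧ (v.2 = u.2 + 1 ∨ u.2 = v.2 + 1)) ∨ (u.2 = v.2 ∧ (v.1 = u.1 + 1 ∨ u.1 = v.1 + 1))

open Classical in
/-- The step from `u` to `v` is a horizontal edge over the column `[i, i + 1]`, above height `j`;
that is, it crosses the vertical ray that goes up from the lattice cell with lower left
corner `(i, j)`. -/
noncomputable def crossing (i j : ℤ) (u v : ℤ × ℤ) : ZMod 2 :=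
  if u.2 = v.2 ∧ j < u.2 ∧ ((u.1 = i ∧ v.1 = i + 1) ∨ (v.1 = i ∧ u.1 = i + 1)) then 1 else 0

theorem crossing_ne_zero {i j : ℤ} {u v : ℤ × ℤ} (h : crossing i j u v ≠ 0) :
    u.2 = v.2 ∧ j < u.2 ∧ ((u.1 = i ∧ v.1 = i + 1) ∨ (v.1 = i ∧ u.1 = i + 1)) := by
  by_contra hc
  exact h (if_neg hc)

/-- The crossing parities of two cells on top of each other differ only if the walk uses the edge
between them. -/
theorem edge_of_walkSum_crossing_ne_vertical {E : ℤ × ℤ → ℤ × ℤ → Prop}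
    (hsymm : ∀ u v, E u v → E v u)
    {v w : ℤ × ℤ} {L : List (ℤ × ℤ)} (hw : IsWalk E v L w) {i j : ℤ}
    (h : walkSum (crossing i j) v L w ≠ walkSum (crossing i (j + 1)) v L w) :
    E (i, j + 1) (i + 1, j + 1) := by
  have h' : walkSum (fun u u' => crossing i j u u' + crossing i (j + 1) u u') v L w ≠ 0 := by
    rw [walkSum_add]
    intro h0
    exact h (by rw [eq_neg_of_add_eq_zero_left h0]; exact ZMod.neg_eq_self_mod_two _)
  obtain ⟨⟨a, b⟩, ⟨a', b'⟩, hE, hne⟩ := hw.exists_step_of_walkSum_ne_zero h'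
  unfold crossing at hne
  dsimp only at hne
  have h2 : (1 : ZMod 2) + 1 = 0 := by decide
  split_ifs at hne with h1 h3 h3
  · exact absurd h2 hne
  · obtain ⟨rfl, hb, h | h⟩ := h1
    · obtain ⟨rfl, rfl⟩ := h
      obtain rfl : b = j + 1 := by omega
      exact hE
    · obtain ⟨rfl, rfl⟩ := h
      obtain rfl : b = j + 1 := by omega
      exact hsymm _ _ hE
  · omega
  · simp at hne

/-- The crossing parities of two cells next to each other differ only if the walk uses the edge
between them: for a closed walk, the number of steps into and out of the half-line above that edge
is even. -/
theorem edge_of_walkSum_crossing_ne_horizontal {E : ℤ × ℤ → ℤ × ℤ → Prop}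
    (hsymm : ∀ u v, E u v → E v u) (hadj : ∀ u v, E u v → LatticeAdj u v)
    {v : ℤ × ℤ} {L : List (ℤ × ℤ)} (hw : IsWalk E v L v) {i j : ℤ}
    (h : walkSum (crossing i j) v L v ≠ walkSum (crossing (i + 1) j) v L v) :
    E (i + 1, j) (i + 1, j + 1) := by
  by_contra hE
  have h' : walkSum (fun u u' => crossing i j u u' + crossing (i + 1) j u u') v L v = 0 := by
    classical
    rw [hw.walkSum_eq_sub (g := fun u => if u.1 = i + 1 ∧ j < u.2 then 1 else 0)]
    · simp
    · rintro ⟨a, b⟩ ⟨a', b'⟩ hu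
      have h1 : ¬ (a = i + 1 ∧ a' = i + 1 ∧ b = j ∧ b' = j + 1) := by
        rintro ⟨rfl, rfl, rfl, rfl⟩; exact hE hu
      have h2 : ¬ (a = i + 1 ∧ a' = i + 1 ∧ b' = j ∧ b = j + 1) := by
        rintro ⟨rfl, rfl, rfl, rfl⟩; exact hE (hsymm _ _ hu)
      have h3 := hadj _ _ hu
      have e1 : (0 : ZMod 2) - 1 = 1 := by decide
      unfold crossing
      unfold LatticeAdj at h3
      dsimp only at h3 ⊢
      split_ifs <;> first | (exfalso; omega) | simp [e1]
  rw [walkSum_add] at h'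
  exact h (by rw [eq_neg_of_add_eq_zero_left h']; exact ZMod.neg_eq_self_mod_two _)

/-- A cell below a closed walk has even crossing parity. -/
theorem walkSum_crossing_eq_zero_of_below {E : ℤ × ℤ → ℤ × ℤ → Prop}
    (hadj : ∀ u v, E u v → LatticeAdj u v)
    {v : ℤ × ℤ} {L : List (ℤ × ℤ)} (hw : IsWalk E v L v) {i j : ℤ}
    (hv : j < v.2) (hL : ∀ x ∈ L, j < x.2) : walkSum (crossing i j) v L v = 0 := by
  classical
  have hw' := hw.restrict (S := fun u => j < u.2) hv hv hL
  rw [hw'.walkSum_eq_sub (g := fun u => if i < u.1 then 1 else 0)]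
  · simp
  · rintro ⟨a, b⟩ ⟨a', b'⟩ ⟨hu, h1, h2⟩
    have h3 := hadj _ _ hu
    have e1 : (0 : ZMod 2) - 1 = 1 := by decide
    unfold crossing
    unfold LatticeAdj at h3
    dsimp only at h1 h2 h3 ⊢
    split_ifs <;> first | (exfalso; omega) | simp [e1]

/-- The cells enclosed by a closed walk, in the sense of crossing parity, form a finite set whose
boundary edges belong to the walk. -/
theorem exists_finset_crossing {E : ℤ × ℤ → ℤ × ℤ → Prop}
    (hsymm : ∀ u v, E u v → E v u) (hadj : ∀ u v, E u v → LatticeAdj u v)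
    {v : ℤ × ℤ} {L : List (ℤ × ℤ)} (hw : IsWalk E v L v) :
    ∃ F : Finset (ℤ × ℤ), (∀ i j, (i, j) ∈ F ↔ walkSum (crossing i j) v L v ≠ 0) ∧
      (∀ i j, ¬((i, j) ∈ F ↔ (i, j + 1) ∈ F) → E (i, j + 1) (i + 1, j + 1)) ∧
      (∀ i j, ¬((i, j) ∈ F ↔ (i + 1, j) ∈ F) → E (i + 1, j) (i + 1, j + 1)) := by
  obtain ⟨K, hK⟩ : ∃ K : ℤ, ∀ u ∈ v :: L, |u.1| ≤ K ∧ |u.2| ≤ K := by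
    generalize v :: L = M
    induction M with
    | nil => exact ⟨0, by simp⟩
    | cons u M ih =>
      obtain ⟨K, hK⟩ := ih
      refine ⟨max K (max |u.1| |u.2|), fun x hx => ?_⟩
      rcases List.mem_cons.1 hx with rfl | hx
      · constructor <;> simp
      · have := hK x hx
        exact ⟨this.1.trans (le_max_left _ _), this.2.trans (le_max_left _ _)⟩
  have hKv := hK v (by simp)
  have hKL : ∀ u ∈ L, |u.1| ≤ K ∧ |u.2| ≤ K := fun u hu => hK u (by simp [hu])
  have hfin : {c : ℤ × ℤ | walkSum (crossing c.1 c.2) v L v ≠ 0}.Finite := by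
    refine (Set.toFinite (Finset.Icc ((-K - 1, -K - 1) : ℤ × ℤ) (K, K) : Set (ℤ × ℤ))).subset ?_
    rintro ⟨i, j⟩ hij
    obtain ⟨⟨a, b⟩, ⟨a', b'⟩, ⟨-, h1, h2⟩, hne⟩ :=
      (hw.restrict (S := fun u => |u.1| ≤ K ∧ |u.2| ≤ K) hKv hKv
        hKL).exists_step_of_walkSum_ne_zero hij
    have h3 := crossing_ne_zero hne
    have hj : -K - 1 ≤ j := by
      by_contra! hj
      refine hij (walkSum_crossing_eq_zero_of_below hadj hw ?_ fun x hx => ?_)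
      · have := abs_le.1 hKv.2
        dsimp only; omega
      · have := abs_le.1 (hKL x hx).2
        dsimp only; omega
    dsimp only at h1 h2 h3
    simp only [abs_le] at h1 h2
    simp only [Finset.coe_Icc, Set.mem_Icc, Prod.mk_le_mk]
    omega
  have key : ∀ x y : ZMod 2, ¬(x ≠ 0 ↔ y ≠ 0) → x ≠ y := by decide
  refine ⟨hfin.toFinset, by simp, fun i j h => ?_, fun i j h => ?_⟩
  · simp only [Set.Finite.mem_toFinset, Set.mem_ofPred_eq] at h
    exact edge_of_walkSum_crossing_ne_vertical hsymm hw (key _ _ h)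
  · simp only [Set.Finite.mem_toFinset, Set.mem_ofPred_eq] at h
    exact edge_of_walkSum_crossing_ne_horizontal hsymm hadj hw (key _ _ h)


theorem walkProd_rotate [Group G] (τ : α → α → G) (v x : α) (L₁ L₂ : List α) :
    walkProd τ v (L₁ ++ x :: L₂) v = 1 ↔ walkProd τ x (L₂ ++ v :: L₁) x = 1 := by
  rw [walkProd_append, walkProd_append]
  exact mul_eq_one_comm

/-- The top left vertex of a closed walk without repeated vertices has an enclosed cell below and
to the right of it. -/
theorem crossing_corner {E : ℤ × ℤ → ℤ × ℤ → Prop} {a b : ℤ} {s p : ℤ × ℤ} {M : List (ℤ × ℤ)}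
    (hw : IsWalk E (a, b) (s :: (M ++ [p])) (a, b))
    (htop : ∀ x ∈ s :: (M ++ [p]), x.2 < b ∨ (x.2 = b ∧ a ≤ x.1))
    (hc : (a, b) ∉ s :: (M ++ [p]))
    (hsp : (s = (a + 1, b) ∧ p = (a, b - 1)) ∨ (p = (a + 1, b) ∧ s = (a, b - 1))) :
    walkSum (crossing a (b - 1)) (a, b) (s :: (M ++ [p])) (a, b) ≠ 0 := by
  have hmid : walkSum (crossing a (b - 1)) s M p = 0 := by
    by_contra hne
    rw [IsWalk, isWalk_append] at hw
    obtain ⟨⟨x, y⟩, ⟨x', y'⟩, ⟨-, h1, h2⟩, hne⟩ := (hw.2.1.restrict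
      (S := fun u => u ∈ s :: (M ++ [p])) (by simp) (by simp)
      (fun x hx => by simp [hx])).exists_step_of_walkSum_ne_zero hne
    have h3 := crossing_ne_zero hne
    have h4 := htop _ h1
    have h5 := htop _ h2
    dsimp only at h3 h4 h5
    obtain ⟨h6, h7, h8 | h8⟩ := h3
    · obtain rfl : x = a := h8.1
      obtain rfl : y = b := by omega
      exact hc h1
    · obtain rfl : x' = a := h8.1
      obtain rfl : y' = b := by omega
      exact hc h2
  rw [walkSum, walkSum_append, hmid, walkSum]
  rcases hsp with ⟨rfl, rfl⟩ | ⟨rfl, rfl⟩ <;> simp [crossing]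

/-- Holonomy around closed lattice walks. Let `τ` label the admissible edges `E` of the lattice by
elements of a group, opposite directions getting inverse labels, and let the labels commute around
every admissible cell (a cell is named by its lower left corner). If every finite union of cells
whose boundary edges are admissible consists of admissible cells, the product of the labels along
every closed walk is trivial.

A walk that visits a vertex twice splits into two shorter ones. Otherwise the cell at the top left
corner is enclosed by the walk, hence admissible, and the corner may be pushed across it. -/
theorem walkProd_eq_one [Group G] {E : ℤ × ℤ → ℤ × ℤ → Prop} {τ : ℤ × ℤ → ℤ × ℤ → G}
    {Cell : ℤ × ℤ → Prop}
    (hsymm : ∀ u v, E u v → E v u) (hadj : ∀ u v, E u v → LatticeAdj u v)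
    (hinv : ∀ u v, E u v → τ u v * τ v u = 1)
    (hcell : ∀ i j, Cell (i, j) → E (i, j) (i + 1, j) ∧ E (i + 1, j) (i + 1, j + 1) ∧
      τ (i, j) (i, j + 1) * τ (i, j + 1) (i + 1, j + 1) =
        τ (i, j) (i + 1, j) * τ (i + 1, j) (i + 1, j + 1))
    (hfill : ∀ F : Finset (ℤ × ℤ),
      (∀ i j, ¬((i, j) ∈ F ↔ (i, j + 1) ∈ F) → E (i, j + 1) (i + 1, j + 1)) →
      (∀ i j, ¬((i, j) ∈ F ↔ (i + 1, j) ∈ F) → E (i + 1, j) (i + 1, j + 1)) →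
      ∀ c ∈ F, Cell c)
    {v : ℤ × ℤ} {L : List (ℤ × ℤ)} (hw : IsWalk E v L v) : walkProd τ v L v = 1 := by
  -- All vertices stay in the quadrant `-K ≤ u.2`, `u.1 ≤ K`; there `u.2 - u.1 + 2 * K` is a
  -- nonnegative weight, whose sum over the vertices drops when a top left corner is pushed in.
  obtain ⟨K, hK⟩ : ∃ K : ℤ, ∀ u ∈ v :: L, -K ≤ u.2 ∧ u.1 ≤ K := by
    generalize v :: L = M
    induction M with
    | nil => exact ⟨0, by simp⟩
    | cons u M ih =>
      obtain ⟨K, hK⟩ := ih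
      refine ⟨max K (max u.1 (-u.2)), fun x hx => ?_⟩
      rcases List.mem_cons.1 hx with rfl | hx
      · omega
      · have := hK x hx
        omega
  let wt : ℤ × ℤ → ℕ := fun u => (u.2 - u.1 + 2 * K).toNat
  obtain ⟨m, hm⟩ : ∃ m, L.length = m := ⟨_, rfl⟩
  induction m using Nat.strong_induction_on generalizing v L with
  | _ m ihm =>
  obtain ⟨N, hN⟩ : ∃ N, ((v :: L).map wt).sum = N := ⟨_, rfl⟩
  induction N using Nat.strong_induction_on generalizing v L with
  | _ N ihN =>
  -- a walk that comes back to its base point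
  by_cases hvL : v ∈ L
  · obtain ⟨L₁, L₂, rfl⟩ := List.append_of_mem hvL
    rw [isWalk_append] at hw
    simp only [List.length_append, List.length_cons] at hm
    rw [walkProd_append, ihm L₁.length (by omega) hw.1 (fun u hu => hK u (by simp at hu ⊢; tauto))
      rfl, ihm L₂.length (by omega) hw.2 (fun u hu => hK u (by simp at hu ⊢; tauto)) rfl, one_mul]
  -- a walk that visits another vertex twice
  by_cases hnd : L.Nodup
  swap
  · obtain ⟨x, hx⟩ : ∃ x, List.Duplicate x L := by
      by_contra! h
      exact hnd (List.nodup_iff_forall_not_duplicate.2 h)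
    obtain ⟨L₁, L₂, L₃, rfl⟩ : ∃ L₁ L₂ L₃, L = L₁ ++ x :: (L₂ ++ x :: L₃) := by
      clear * - hx
      induction hx with
      | cons_mem h =>
        obtain ⟨A, B, rfl⟩ := List.append_of_mem h
        exact ⟨[], A, B, rfl⟩
      | @cons_duplicate y l h ih =>
        obtain ⟨A, B, C, rfl⟩ := ih
        exact ⟨y :: A, B, C, rfl⟩
    rw [isWalk_append, isWalk_append] at hw
    simp only [List.length_append, List.length_cons] at hm
    have h1 := ihm L₂.length (by omega) hw.2.1 (fun u hu => hK u (by simp at hu ⊢; tauto)) rfl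
    have h2 := ihm (L₁ ++ x :: L₃).length (by simp; omega) (v := v) (L := L₁ ++ x :: L₃)
      ((isWalk_append _ _ _ _ _ _).2 ⟨hw.1, hw.2.2⟩)
      (fun u hu => hK u (by simp at hu ⊢; tauto)) rfl
    rw [walkProd_append] at h2
    rw [walkProd_append, walkProd_append, h1, one_mul, h2]
  -- the top left vertex
  obtain ⟨c, hcL, hmax⟩ := (v :: L).toFinset.exists_max_image
    (fun u => toLex (u.2, -u.1)) ⟨v, by simp⟩
  obtain ⟨a, b⟩ := c
  obtain ⟨M, hMw, hMprod, hMperm⟩ : ∃ M, IsWalk E (a, b) M (a, b) ∧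
      (walkProd τ (a, b) M (a, b) = 1 → walkProd τ v L v = 1) ∧
      ((a, b) :: M).Perm (v :: L) := by
    rcases List.mem_cons.1 (List.mem_toFinset.1 hcL) with rfl | hcL
    · exact ⟨L, hw, id, List.Perm.refl _⟩
    · obtain ⟨L₁, L₂, rfl⟩ := List.append_of_mem hcL
      refine ⟨L₂ ++ v :: L₁, ?_, (walkProd_rotate _ _ _ _ _).2, ?_⟩
      · rw [isWalk_append] at hw ⊢
        exact hw.symm
      · rw [← List.cons_append, ← List.cons_append]
        exact List.perm_append_comm
  have hMnd : ((a, b) :: M).Nodup := hMperm.nodup_iff.2 (List.nodup_cons.2 ⟨hvL, hnd⟩)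
  have hMmem : ∀ u, u ∈ (a, b) :: M ↔ u ∈ v :: L := fun u => hMperm.mem_iff
  have hMlen : M.length = m := by
    have := hMperm.length_eq
    simp only [List.length_cons] at this
    omega
  have hMwt := (hMperm.map wt).sum_eq
  apply hMprod
  have htop : ∀ x ∈ M, x.2 < b ∨ (x.2 = b ∧ a ≤ x.1) := by
    intro x hx
    have h := hmax x (List.mem_toFinset.2 ((hMmem x).1 (by simp [hx])))
    rw [Prod.Lex.toLex_le_toLex] at h
    dsimp only at h
    omega
  replace hK : ∀ u ∈ (a, b) :: M, -K ≤ u.2 ∧ u.1 ≤ K := fun u hu => hK u ((hMmem u).1 hu)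
  rw [← hMwt] at hN
  clear hMprod hMperm hMmem hMwt hmax hcL hnd hvL hw hm
  cases M with
  | nil => 
    have := hadj _ _ hMw
    simp [LatticeAdj] at this
  | cons s M =>
  rcases List.eq_nil_or_concat M with rfl | ⟨M, p, rfl⟩
  · exact hinv _ _ hMw.1
  rw [List.concat_eq_append] at *
  have hsE : E (a, b) s := hMw.1
  have hpE : E p (a, b) := ((isWalk_append E _ _ _ _ []).1 hMw.2).2
  have hsp : s ≠ p := by
    rintro rfl
    simp at hMnd
  have hs1 := hadj _ _ hsE
  have hp1 := hadj _ _ hpE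
  have htop_s := htop s (by simp)
  have htop_p := htop p (by simp)
  have hcases : (s = (a + 1, b) ∧ p = (a, b - 1)) ∨ (p = (a + 1, b) ∧ s = (a, b - 1)) := by
    obtain ⟨s1, s2⟩ := s
    obtain ⟨p1, p2⟩ := p
    simp only [ne_eq, Prod.mk.injEq, LatticeAdj] at *
    omega
  obtain ⟨F, hF, hF1, hF2⟩ := exists_finset_crossing hsymm hadj hMw
  have hC : Cell (a, b - 1) := hfill F hF1 hF2 _
    ((hF _ _).2 (crossing_corner hMw htop (List.nodup_cons.1 hMnd).1 hcases))
  obtain ⟨e1, e2, e3⟩ := hcell _ _ hC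
  rw [sub_add_cancel] at e2 e3
  have hKe : ∀ u ∈ (a + 1, b - 1) :: s :: (M ++ [p]), -K ≤ u.2 ∧ u.1 ≤ K := by
    intro u hu
    rcases List.mem_cons.1 hu with rfl | hu
    · have h1 := hK s (by simp)
      have h2 := hK p (by simp)
      rcases hcases with ⟨rfl, rfl⟩ | ⟨rfl, rfl⟩ <;> exact ⟨by omega, by omega⟩
    · exact hK u (by simp only [List.mem_cons] at hu ⊢; tauto)
  have hwt : wt (a + 1, b - 1) + 1 ≤ wt (a, b) := by
    have h1 := hKe (a + 1, b - 1) (by simp)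
    have h2 := hK (a, b) (by simp)
    simp only [wt]
    omega
  simp only [List.map_cons, List.sum_cons] at hN
  have hnew : IsWalk E (a + 1, b - 1) (s :: (M ++ [p])) (a + 1, b - 1) := by
    rw [IsWalk, isWalk_append] at hMw ⊢
    rcases hcases with ⟨rfl, rfl⟩ | ⟨rfl, rfl⟩
    · exact ⟨e2, hMw.2.1, e1⟩
    · exact ⟨hsymm _ _ e1, hMw.2.1, hsymm _ _ e2⟩
  have hres := ihN _ (by simp only [List.map_cons, List.sum_cons]; omega) hnew hKe hMlen rfl
  rw [walkProd, walkProd_append, walkProd] at hres ⊢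
  have r1 : ∀ x y, E x y → τ x y = (τ y x)⁻¹ := fun x y h => eq_inv_of_mul_eq_one_left (hinv x y h)
  have hpush : τ p (a, b) * τ (a, b) s = τ p (a + 1, b - 1) * τ (a + 1, b - 1) s := by
    rcases hcases with ⟨rfl, rfl⟩ | ⟨rfl, rfl⟩
    · exact e3
    · rw [r1 _ _ hpE, r1 _ _ hsE, r1 _ _ (hsymm _ _ e2), r1 _ _ (hsymm _ _ e1), ← mul_inv_rev,
        ← mul_inv_rev, e3]
  have rot : ∀ x y z : G, x * (y * z) = 1 ↔ (z * x) * y = 1 := fun x y z => by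
    rw [← mul_assoc, mul_eq_one_comm, mul_assoc]
  rw [rot] at hres ⊢
  rw [hpush, hres]

end LatticeWalks

/-! ### Labelling paths by loops -/

section PathLabel

open CategoryTheory

variable {X : Type*} [TopologicalSpace X]

/-- The class of a path, as a morphism of the fundamental groupoid. -/
def pathHom {y z : X} (p : Path y z) : FundamentalGroupoid.mk y ⟶ FundamentalGroupoid.mk z :=
  Path.Homotopic.Quotient.mk p

theorem pathHom_trans {y z w : X} (p : Path y z) (q : Path z w) :
    pathHom (p.trans q) = pathHom p ≫ pathHom q := rfl

theorem pathHom_eq_iff {y z : X} {p q : Path y z} : pathHom p = pathHom q ↔ p.Homotopic q :=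
  Path.Homotopic.Quotient.eq

/-- The class of a path, made into an element of the fundamental group at `x₀` by joining its
endpoints to `x₀` along chosen paths. The opposite of the endomorphism monoid is used so that
concatenation of paths corresponds to multiplication from left to right. -/
noncomputable def pathLabel [PathConnectedSpace X] (x₀ : X) {y z : X} (p : Path y z) :
    (End (FundamentalGroupoid.mk x₀))ᵐᵒᵖ :=
  .op (pathHom (PathConnectedSpace.somePath x₀ y) ≫ pathHom p ≫
    Groupoid.inv (pathHom (PathConnectedSpace.somePath x₀ z)))

variable [PathConnectedSpace X] (x₀ : X) {y z w : X}

theorem pathLabel_trans (p : Path y z) (q : Path z w) :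
    pathLabel x₀ (p.trans q) = pathLabel x₀ p * pathLabel x₀ q := by
  unfold pathLabel
  rw [← MulOpposite.op_mul, End.mul_def, pathHom_trans]
  simp

variable {x₀} in
theorem pathLabel_congr {p q : Path y z} (h : p.Homotopic q) :
    pathLabel x₀ p = pathLabel x₀ q := by
  unfold pathLabel
  rw [pathHom_eq_iff.2 h]

theorem pathLabel_cast {y' z' : X} (p : Path y z) (hy : y' = y) (hz : z' = z) :
    pathLabel x₀ (p.cast hy hz) = pathLabel x₀ p := by
  subst hy hz
  rfl

theorem pathLabel_refl : pathLabel x₀ (Path.refl y) = 1 := by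
  have h := pathLabel_trans x₀ (Path.refl y) (Path.refl y)
  rw [Path.refl_trans_refl] at h
  exact (mul_eq_left.1 h.symm)

theorem homotopic_refl_of_pathLabel_eq_one {p : Path y y} (h : pathLabel x₀ p = 1) :
    p.Homotopic (Path.refl y) := by
  rw [← pathLabel_refl x₀ (y := y)] at h
  unfold pathLabel at h
  have h2 := MulOpposite.op_injective h
  rw [cancel_epi, cancel_mono] at h2
  exact pathHom_eq_iff.1 h2

end PathLabel

/-! ### Segments in a plane set -/

section Segments

variable {Ω : Set ℂ}

/-- Two paths in `Ω` that stay in a convex subset are homotopic. -/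
theorem homotopic_of_forall_mem_convex {C : Set ℂ} (hC : Convex ℝ C) (hCΩ : C ⊆ Ω) {y z : Ω}
    (p q : Path y z) (hp : ∀ t, (p t : ℂ) ∈ C) (hq : ∀ t, (q t : ℂ) ∈ C) : p.Homotopic q := by
  have hy : (y : ℂ) ∈ C := by simpa using hp 0
  have hz : (z : ℂ) ∈ C := by simpa using hp 1
  have := hC.contractibleSpace ⟨_, hy⟩
  let lift : ∀ r : Path y z, (∀ t, (r t : ℂ) ∈ C) → Path (⟨y, hy⟩ : C) ⟨z, hz⟩ := fun r hr =>
    { toFun := fun t => ⟨r t, hr t⟩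
      continuous_toFun := by fun_prop
      source' := by simp
      target' := by simp }
  have h := (SimplyConnectedSpace.paths_homotopic (lift p hp) (lift q hq)).map
    ⟨Set.inclusion hCΩ, continuous_inclusion hCΩ⟩
  convert! h using 1

/-- The straight path between two points of `Ω` joined by a segment in `Ω`. -/
noncomputable def segmentPath (y z : ℂ) (h : segment ℝ y z ⊆ Ω) :
    Path (⟨y, h (left_mem_segment ℝ y z)⟩ : Ω) ⟨z, h (right_mem_segment ℝ y z)⟩ where
  toFun t := ⟨Path.segment y z t, h (Path.range_segment y z ▸ Set.mem_range_self t)⟩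
  continuous_toFun := by fun_prop
  source' := by simp
  target' := by simp

theorem segmentPath_mem (y z : ℂ) (h : segment ℝ y z ⊆ Ω) (t) :
    (segmentPath y z h t : ℂ) ∈ segment ℝ y z :=
  Path.range_segment y z ▸ Set.mem_range_self t

open Classical in
/-- The label of the straight path between two points of `Ω`; the value is `1` if the segment
between the points is not contained in `Ω`. -/
noncomputable def segmentLabel [PathConnectedSpace Ω] (x₀ : Ω) (y z : ℂ) :
    (CategoryTheory.End (FundamentalGroupoid.mk x₀))ᵐᵒᵖ :=
  if h : segment ℝ y z ⊆ Ω then pathLabel x₀ (segmentPath y z h) else 1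

variable [PathConnectedSpace Ω] (x₀ : Ω)

theorem pathLabel_eq_segmentLabel {C : Set ℂ} (hC : Convex ℝ C) (hCΩ : C ⊆ Ω) {y z : Ω}
    (p : Path y z) (hp : ∀ t, (p t : ℂ) ∈ C) : pathLabel x₀ p = segmentLabel x₀ y z := by
  have hs : segment ℝ (y : ℂ) z ⊆ C :=
    hC.segment_subset (by simpa using hp 0) (by simpa using hp 1)
  rw [segmentLabel, dif_pos (hs.trans hCΩ)]
  exact pathLabel_congr (homotopic_of_forall_mem_convex hC hCΩ _ _ hp
    fun t => hs (segmentPath_mem _ _ _ t))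

theorem segmentLabel_mul {C : Set ℂ} (hC : Convex ℝ C) (hCΩ : C ⊆ Ω) {x y z : ℂ}
    (hx : x ∈ C) (hy : y ∈ C) (hz : z ∈ C) :
    segmentLabel x₀ x y * segmentLabel x₀ y z = segmentLabel x₀ x z := by
  have hxy := hC.segment_subset hx hy
  have hyz := hC.segment_subset hy hz
  have h := pathLabel_eq_segmentLabel x₀ hC hCΩ
    ((segmentPath x y (hxy.trans hCΩ)).trans (segmentPath y z (hyz.trans hCΩ))) ?_
  · rw [pathLabel_trans] at h
    rw [← h, segmentLabel, segmentLabel, dif_pos (hxy.trans hCΩ), dif_pos (hyz.trans hCΩ)]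
  · intro t
    rw [Path.trans_apply]
    split_ifs
    · exact hxy (segmentPath_mem _ _ _ _)
    · exact hyz (segmentPath_mem _ _ _ _)

theorem segmentLabel_self (y : ℂ) : segmentLabel x₀ y y = 1 := by
  by_cases h : segment ℝ y y ⊆ Ω
  · have := segmentLabel_mul x₀ (convex_segment y y) h (left_mem_segment ℝ y y)
      (left_mem_segment ℝ y y) (left_mem_segment ℝ y y)
    exact mul_eq_left.1 this
  · rw [segmentLabel, dif_neg h]

end Segments

/-! ### The square grid in the plane -/

section Grid

/-- The point of the square grid of mesh `δ` with integer coordinates `u`. -/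
def gridPoint (δ : ℝ) (u : ℤ × ℤ) : ℂ := ⟨δ * u.1, δ * u.2⟩

/-- The closed cell of the grid of mesh `δ` with lower left corner `gridPoint δ c`. -/
def gridCell (δ : ℝ) (c : ℤ × ℤ) : Set ℂ :=
  Set.Icc (δ * c.1) (δ * (c.1 + 1)) ×ℂ Set.Icc (δ * c.2) (δ * (c.2 + 1))

theorem mem_gridCell {δ : ℝ} {c : ℤ × ℤ} {z : ℂ} : z ∈ gridCell δ c ↔
    (δ * c.1 ≤ z.re ∧ z.re ≤ δ * (c.1 + 1)) ∧ (δ * c.2 ≤ z.im ∧ z.im ≤ δ * (c.2 + 1)) := Iff.rfl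

theorem convex_gridCell (δ : ℝ) (c : ℤ × ℤ) : Convex ℝ (gridCell δ c) :=
  ((convex_Icc _ _).linear_preimage Complex.reLm).inter
    ((convex_Icc _ _).linear_preimage Complex.imLm)

theorem isCompact_gridCell (δ : ℝ) (c : ℤ × ℤ) : IsCompact (gridCell δ c) :=
  isCompact_Icc.reProdIm isCompact_Icc

theorem mem_segment_of_im_eq {δ : ℝ} (hδ : 0 < δ) {i j : ℤ} {z : ℂ} (h₁ : δ * i ≤ z.re)
    (h₂ : z.re ≤ δ * (i + 1)) (h : z.im = δ * j) :
    z ∈ segment ℝ (gridPoint δ (i, j)) (gridPoint δ (i + 1, j)) := by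
  rw [segment_eq_image_lineMap]
  refine ⟨z.re / δ - i, ⟨?_, ?_⟩, ?_⟩
  · rw [sub_nonneg, le_div_iff₀ hδ]; linarith
  · rw [sub_le_iff_le_add, div_le_iff₀ hδ]; linarith
  · apply Complex.ext
    · simp [gridPoint, AffineMap.lineMap_apply]; field_simp; ring
    · simp [gridPoint, AffineMap.lineMap_apply, h]

theorem mem_segment_of_re_eq {δ : ℝ} (hδ : 0 < δ) {i j : ℤ} {z : ℂ} (h₁ : δ * j ≤ z.im)
    (h₂ : z.im ≤ δ * (j + 1)) (h : z.re = δ * i) :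
    z ∈ segment ℝ (gridPoint δ (i, j)) (gridPoint δ (i, j + 1)) := by
  rw [segment_eq_image_lineMap]
  refine ⟨z.im / δ - j, ⟨?_, ?_⟩, ?_⟩
  · rw [sub_nonneg, le_div_iff₀ hδ]; linarith
  · rw [sub_le_iff_le_add, div_le_iff₀ hδ]; linarith
  · apply Complex.ext
    · simp [gridPoint, AffineMap.lineMap_apply, h]
    · simp [gridPoint, AffineMap.lineMap_apply]; field_simp; ring

theorem eventually_floor_le_le_floor_add_one (t : ℝ) :
    ∀ᶠ s in nhds t, (⌊s⌋ : ℝ) ≤ t ∧ t ≤ ⌊s⌋ + 1 := by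
  filter_upwards [gt_mem_nhds (Int.lt_floor_add_one t),
    lt_mem_nhds (sub_lt_iff_lt_add.2 (Int.ceil_lt_add_one t))] with s h₁ h₂
  constructor
  · have : ⌊s⌋ < ⌊t⌋ + 1 := Int.floor_lt.2 (by exact_mod_cast h₁)
    exact (Int.cast_le.2 (Int.lt_add_one_iff.1 this)).trans (Int.floor_le t)
  · have : ⌈t⌉ - 1 ≤ ⌊s⌋ := Int.le_floor.2 (by push_cast; exact h₂.le)
    have h3 : (⌈t⌉ : ℝ) - 1 ≤ ⌊s⌋ := by exact_mod_cast this
    linarith [Int.le_ceil t]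

theorem mem_gridCell_floor {δ : ℝ} (hδ : 0 < δ) (z : ℂ) :
    z ∈ gridCell δ (⌊z.re / δ⌋, ⌊z.im / δ⌋) := by
  have h (x : ℝ) : δ * ⌊x / δ⌋ ≤ x ∧ x ≤ δ * (⌊x / δ⌋ + 1) := by
    constructor
    · rw [mul_comm, ← le_div_iff₀ hδ]; exact Int.floor_le _
    · rw [mul_comm, ← div_le_iff₀ hδ]; exact (Int.lt_floor_add_one _).le
  exact ⟨h _, h _⟩

/-- Points close to `x` lie in a common cell with `x`. -/
theorem eventually_exists_gridCell {δ : ℝ} (hδ : 0 < δ) (x : ℂ) :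
    ∀ᶠ z in nhds x, ∃ c, z ∈ gridCell δ c ∧ x ∈ gridCell δ c := by
  have h₁ := ((Complex.continuous_re.div_const δ).tendsto x).eventually
    (eventually_floor_le_le_floor_add_one (x.re / δ))
  have h₂ := ((Complex.continuous_im.div_const δ).tendsto x).eventually
    (eventually_floor_le_le_floor_add_one (x.im / δ))
  filter_upwards [h₁, h₂] with z h₁ h₂
  refine ⟨_, mem_gridCell_floor hδ z, ?_⟩
  rw [le_div_iff₀ hδ, div_le_iff₀ hδ] at h₁ h₂
  exact ⟨⟨by linarith, by linarith⟩, ⟨by linarith, by linarith⟩⟩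

theorem eq_add_one_of_mem_Icc {δ : ℝ} (hδ : 0 < δ) {i j : ℤ} {t : ℝ} (hij : i ≠ j)
    (hi : δ * i ≤ t ∧ t ≤ δ * (i + 1)) (hj : δ * j ≤ t ∧ t ≤ δ * (j + 1)) :
    (j = i + 1 ∧ t = δ * (i + 1)) ∨ (i = j + 1 ∧ t = δ * (j + 1)) := by
  have h₁ : (i : ℝ) ≤ j + 1 := le_of_mul_le_mul_left (hi.1.trans hj.2) hδ
  have h₂ : (j : ℝ) ≤ i + 1 := le_of_mul_le_mul_left (hj.1.trans hi.2) hδ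
  have h₃ : i ≤ j + 1 := by exact_mod_cast h₁
  have h₄ : j ≤ i + 1 := by exact_mod_cast h₂
  rcases (by omega : j = i + 1 ∨ i = j + 1) with rfl | rfl
  · refine Or.inl ⟨rfl, le_antisymm hi.2 ?_⟩
    exact_mod_cast hj.1
  · refine Or.inr ⟨rfl, le_antisymm hj.2 ?_⟩
    exact_mod_cast hi.1

/-- If the boundary edges of a finite union of cells lie in `Ω`, so do the cells, provided that `Ω`
contains each bounded open set whose frontier it contains. -/
theorem gridCell_subset_of_boundary {Ω : Set ℂ}
    (hcut : ∀ V : Set ℂ, IsOpen V → Bornology.IsBounded V → frontier V ⊆ Ω → V ⊆ Ω)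
    {δ : ℝ} (hδ : 0 < δ) (F : Finset (ℤ × ℤ))
    (hF₁ : ∀ i j, ¬((i, j) ∈ F ↔ (i, j + 1) ∈ F) →
      segment ℝ (gridPoint δ (i, j + 1)) (gridPoint δ (i + 1, j + 1)) ⊆ Ω)
    (hF₂ : ∀ i j, ¬((i, j) ∈ F ↔ (i + 1, j) ∈ F) →
      segment ℝ (gridPoint δ (i + 1, j)) (gridPoint δ (i + 1, j + 1)) ⊆ Ω) :
    ∀ c ∈ F, gridCell δ c ⊆ Ω := by
  set A := ⋃ c ∈ F, gridCell δ c with hA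
  have hAc : IsCompact A := F.isCompact_biUnion fun c _ => isCompact_gridCell δ c
  have hfr : frontier A ⊆ Ω := by
    intro x hx
    have hxA : x ∈ A := hAc.isClosed.frontier_subset hx
    obtain ⟨⟨i, j⟩, hcF, hc⟩ := Set.mem_iUnion₂.1 hxA
    obtain ⟨⟨i', j'⟩, hc', hc'F⟩ : ∃ c, x ∈ gridCell δ c ∧ c ∉ F := by
      by_contra! hall
      refine hx.2 (mem_interior_iff_mem_nhds.2 ?_)
      filter_upwards [eventually_exists_gridCell hδ x] with z ⟨c, hz, hxc⟩
      exact Set.mem_iUnion₂.2 ⟨c, hall c hxc, hz⟩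
    rw [mem_gridCell] at hc hc'
    dsimp only at hc hc'
    by_cases hmid : (i', j) ∈ F
    · have hne : j ≠ j' := by rintro rfl; exact hc'F hmid
      rcases eq_add_one_of_mem_Icc hδ hne hc.2 hc'.2 with ⟨rfl, h⟩ | ⟨rfl, h⟩
      · exact hF₁ i' j (by tauto)
          (mem_segment_of_im_eq hδ hc'.1.1 hc'.1.2 (by push_cast; exact h))
      · exact hF₁ i' j' (by tauto)
          (mem_segment_of_im_eq hδ hc'.1.1 hc'.1.2 (by push_cast; exact h))
    · have hne : i ≠ i' := by rintro rfl; exact hmid hcF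
      rcases eq_add_one_of_mem_Icc hδ hne hc.1 hc'.1 with ⟨rfl, h⟩ | ⟨rfl, h⟩
      · exact hF₂ i j (by tauto)
          (mem_segment_of_re_eq hδ hc.2.1 hc.2.2 (by push_cast; exact h))
      · exact hF₂ i' j (by tauto)
          (mem_segment_of_re_eq hδ hc.2.1 hc.2.2 (by push_cast; exact h))
  have hint : interior A ⊆ Ω := hcut _ isOpen_interior (hAc.isBounded.subset interior_subset)
    (frontier_interior_subset.trans hfr)
  intro c hc z hz
  have hzA : z ∈ A := Set.mem_iUnion₂.2 ⟨c, hc, hz⟩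
  by_cases hzi : z ∈ interior A
  · exact hint hzi
  · exact hfr ⟨subset_closure hzA, hzi⟩

variable {Ω : Set ℂ} [PathConnectedSpace Ω] (x₀ : Ω)

/-- The lattice steps that run inside `Ω`. -/
def GridStep (Ω : Set ℂ) (δ : ℝ) (u v : ℤ × ℤ) : Prop :=
  LatticeAdj u v ∧ segment ℝ (gridPoint δ u) (gridPoint δ v) ⊆ Ω

theorem gridPoint_mem_gridCell {δ : ℝ} (hδ : 0 < δ) {i j k l : ℤ} (hk : k = i ∨ k = i + 1)
    (hl : l = j ∨ l = j + 1) : gridPoint δ (k, l) ∈ gridCell δ (i, j) := by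
  rw [mem_gridCell]
  have h (m n : ℤ) (h : m = n ∨ m = n + 1) : δ * n ≤ δ * m ∧ δ * m ≤ δ * (n + 1) := by
    rcases h with rfl | rfl
    · exact ⟨le_rfl, by linarith⟩
    · push_cast
      exact ⟨by linarith, le_rfl⟩
  exact ⟨h _ _ hk, h _ _ hl⟩

/-- The label of the straight path between two lattice points. -/
noncomputable def gridLabel (δ : ℝ) (u v : ℤ × ℤ) :
    (CategoryTheory.End (FundamentalGroupoid.mk x₀))ᵐᵒᵖ :=
  segmentLabel x₀ (gridPoint δ u) (gridPoint δ v)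

/-- Closed grid walks in `Ω` have trivial label. -/
theorem walkProd_gridLabel_eq_one
    (hcut : ∀ V : Set ℂ, IsOpen V → Bornology.IsBounded V → frontier V ⊆ Ω → V ⊆ Ω)
    {δ : ℝ} (hδ : 0 < δ) {v : ℤ × ℤ} {L : List (ℤ × ℤ)} (hw : IsWalk (GridStep Ω δ) v L v) :
    walkProd (gridLabel x₀ δ) v L v = 1 := by
  refine walkProd_eq_one (Cell := fun c => gridCell δ c ⊆ Ω) ?_ (fun u v h => h.1) ?_ ?_ ?_ hw
  · rintro u v ⟨h₁, h₂⟩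
    refine ⟨?_, by rwa [segment_symm]⟩
    rcases h₁ with ⟨h, h'⟩ | ⟨h, h'⟩
    · exact Or.inl ⟨h.symm, h'.symm⟩
    · exact Or.inr ⟨h.symm, h'.symm⟩
  · rintro u v ⟨-, h⟩
    rw [gridLabel, gridLabel, segmentLabel_mul x₀ (convex_segment _ _) h
      (left_mem_segment ..) (right_mem_segment ..) (left_mem_segment ..), segmentLabel_self]
  · intro i j h
    have h00 := gridPoint_mem_gridCell hδ (i := i) (j := j) (.inl rfl) (.inl rfl)
    have h01 := gridPoint_mem_gridCell hδ (i := i) (j := j) (.inl rfl) (.inr rfl)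
    have h10 := gridPoint_mem_gridCell hδ (i := i) (j := j) (.inr rfl) (.inl rfl)
    have h11 := gridPoint_mem_gridCell hδ (i := i) (j := j) (.inr rfl) (.inr rfl)
    have hC := convex_gridCell δ (i, j)
    refine ⟨⟨.inr ⟨rfl, .inl rfl⟩, (hC.segment_subset h00 h10).trans h⟩,
      ⟨.inl ⟨rfl, .inl rfl⟩, (hC.segment_subset h10 h11).trans h⟩, ?_⟩
    simp only [gridLabel]
    rw [segmentLabel_mul x₀ hC h h00 h01 h11, segmentLabel_mul x₀ hC h h00 h10 h11]
  · exact fun F h₁ h₂ => gridCell_subset_of_boundary hcut hδ F (fun i j h => (h₁ i j h).2)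
      fun i j h => (h₂ i j h).2

end Grid

/-! ### Simple connectedness of sets without holes -/

section SimplyConnected

variable {Ω : Set ℂ} [PathConnectedSpace Ω] (x₀ : Ω)

/-- The lower left corner of a grid cell containing `z`. -/
noncomputable def gridFloor (δ : ℝ) (z : ℂ) : ℤ × ℤ := (⌊z.re / δ⌋, ⌊z.im / δ⌋)

theorem floor_div_le_add_one {δ s t : ℝ} (hδ : 0 < δ) (h : |s - t| < δ) :
    ⌊s / δ⌋ ≤ ⌊t / δ⌋ + 1 := by
  rw [← Int.floor_add_one]
  refine Int.floor_le_floor ?_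
  rw [div_add_one hδ.ne']
  gcongr
  linarith [(abs_lt.1 h).2]

theorem gridPoint_mem_ball {δ : ℝ} {z : ℂ} {u : ℤ × ℤ} (h₁ : |z.re - δ * u.1| < 2 * δ)
    (h₂ : |z.im - δ * u.2| < 2 * δ) : gridPoint δ u ∈ Metric.ball z (4 * δ) := by
  rw [Metric.mem_ball, dist_comm, Complex.dist_eq]
  refine (Complex.norm_le_abs_re_add_abs_im _).trans_lt ?_
  simp only [gridPoint, Complex.sub_re, Complex.sub_im]
  linarith

theorem abs_sub_mul_floor_le {δ s t : ℝ} (hδ : 0 < δ) (h : |s - t| < δ) :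
    |s - δ * ⌊t / δ⌋| < 2 * δ := by
  have h₁ : δ * ⌊t / δ⌋ ≤ t := by
    rw [mul_comm, ← le_div_iff₀ hδ]; exact Int.floor_le _
  have h₂ : t < δ * (⌊t / δ⌋ + 1) := by
    rw [mul_comm, ← div_lt_iff₀ hδ]; exact Int.lt_floor_add_one _
  rw [abs_lt] at h ⊢
  constructor <;> linarith

/-- A grid walk can be continued to a neighbouring (or equal) lattice point. -/
theorem exists_walk_extend {δ : ℝ} {C : Set ℂ} (hC : Convex ℝ C) (hCΩ : C ⊆ Ω)
    {v w w' : ℤ × ℤ} (hw : gridPoint δ w ∈ C) (hw' : gridPoint δ w' ∈ C)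
    (h : w = w' ∨ LatticeAdj w w') {L : List (ℤ × ℤ)} (hL : IsWalk (GridStep Ω δ) v L w) :
    ∃ L', IsWalk (GridStep Ω δ) v L' w' ∧
      walkProd (gridLabel x₀ δ) v L' w' =
      walkProd (gridLabel x₀ δ) v L w *
        gridLabel x₀ δ w w' := by
  rcases h with rfl | h
  · exact ⟨L, hL, by rw [gridLabel, segmentLabel_self, mul_one]⟩
  · exact ⟨L ++ [w], (isWalk_append _ _ _ _ _ []).2
      ⟨hL, h, (hC.segment_subset hw hw').trans hCΩ⟩, walkProd_append _ _ _ _ _ []⟩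

/-- An open connected set that contains every bounded open set whose frontier it contains is simply
connected. A loop is cut into short arcs, each of which is replaced by a walk on a fine grid; closed
grid walks have trivial label. -/
theorem isSimplyConnected_of_frontier_subset {Ω : Set ℂ} (hopen : IsOpen Ω) (hconn : IsConnected Ω)
    (hcut : ∀ V : Set ℂ, IsOpen V → Bornology.IsBounded V → frontier V ⊆ Ω → V ⊆ Ω) :
    IsSimplyConnected Ω := by
  have hpc : PathConnectedSpace Ω :=
    isPathConnected_iff_pathConnectedSpace.1 (hopen.isConnected_iff_isPathConnected.1 hconn)
  refine simply_connected_iff_loops_nullhomotopic.2 ⟨hpc, fun x γ => ?_⟩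
  apply homotopic_refl_of_pathLabel_eq_one x
  have hγ : Continuous fun t => (γ t : ℂ) := continuous_subtype_val.comp γ.continuous
  obtain ⟨r, hr, hrΩ⟩ := (isCompact_range hγ).exists_thickening_subset_open hopen
    (by rintro _ ⟨t, rfl⟩; exact (γ t).2)
  obtain ⟨δ, hδ, rfl⟩ : ∃ δ, 0 < δ ∧ r = 4 * δ := ⟨r / 4, by linarith, by ring⟩
  have hball : ∀ t, Metric.ball (γ t : ℂ) (4 * δ) ⊆ Ω := fun t =>
    (Metric.ball_subset_thickening (Set.mem_range_self t) _).trans hrΩ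
  obtain ⟨η, hη, huc⟩ := Metric.uniformContinuous_iff.1
    (CompactSpace.uniformContinuous_of_continuous hγ) δ hδ
  obtain ⟨n, hn⟩ := exists_nat_one_div_lt hη
  -- the subdivision points `k / (n + 1)`
  let t : ℕ → unitInterval := fun k => Set.projIcc 0 1 zero_le_one ((k : ℝ) / (n + 1))
  have ht0 : t 0 = 0 := by simp [t]
  have htn : t (n + 1) = 1 := by
    have : ((n + 1 : ℕ) : ℝ) / (n + 1) = 1 := by push_cast; field_simp
    simp only [t, this]
    exact Set.projIcc_right _
  have hstep : ∀ k, ∀ s ∈ Set.uIcc (t k) (t (k + 1)), dist (γ (t k) : ℂ) (γ s) < δ := by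
    intro k s hs
    apply huc
    have hmono : t k ≤ t (k + 1) := Set.monotone_projIcc _ (by gcongr; simp)
    rw [Set.uIcc_of_le hmono] at hs
    have h1 : (t (k + 1) : ℝ) - t k ≤ 1 / (n + 1) := by
      refine (le_abs_self _).trans ((Set.abs_projIcc_sub_projIcc zero_le_one).trans ?_)
      rw [← sub_div, abs_of_nonneg (by simp; positivity)]
      simp
    rw [Subtype.dist_eq, Real.dist_eq, abs_sub_comm,
      abs_of_nonneg (sub_nonneg.2 (Subtype.coe_le_coe.2 hs.1))]
    have h2 : (s : ℝ) ≤ t (k + 1) := hs.2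
    linarith
  have hself : ∀ k, gridPoint δ (gridFloor δ (γ (t k))) ∈ Metric.ball (γ (t k) : ℂ) (4 * δ) :=
    fun k => gridPoint_mem_ball (abs_sub_mul_floor_le hδ (by simpa))
      (abs_sub_mul_floor_le hδ (by simpa))
  have hclaim : ∀ k, ∃ L, IsWalk (GridStep Ω δ) (gridFloor δ (γ (t 0))) L (gridFloor δ (γ (t k))) ∧
      pathLabel x (γ.subpath (t 0) (t k)) *
        segmentLabel x (γ (t k)) (gridPoint δ (gridFloor δ (γ (t k)))) =
      segmentLabel x (γ (t 0)) (gridPoint δ (gridFloor δ (γ (t 0)))) *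
        walkProd (gridLabel x δ) (gridFloor δ (γ (t 0))) L (gridFloor δ (γ (t k))) := by
    intro k
    induction k with
    | zero =>
      set v := gridFloor δ (γ (t 0)) with hv
      -- a walk has at least one step, so step to the right and back
      have hmem : gridPoint δ (v.1 + 1, v.2) ∈ Metric.ball (γ (t 0) : ℂ) (4 * δ) := by
        refine gridPoint_mem_ball ?_ (abs_sub_mul_floor_le hδ (by simpa))
        have h := mem_gridCell.1 (mem_gridCell_floor hδ (γ (t 0) : ℂ))
        simp only [hv, gridFloor] at h ⊢
        push_cast
        rw [abs_lt]
        constructor <;> linarith [h.1.1, h.1.2]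
      have hC := convex_ball (γ (t 0) : ℂ) (4 * δ)
      have hadj : LatticeAdj v (v.1 + 1, v.2) := .inr ⟨rfl, .inl rfl⟩
      have hadj' : LatticeAdj (v.1 + 1, v.2) v := .inr ⟨rfl, .inr rfl⟩
      refine ⟨[(v.1 + 1, v.2)], ⟨⟨hadj, (hC.segment_subset (hself 0) hmem).trans (hball _)⟩,
        hadj', (hC.segment_subset hmem (hself 0)).trans (hball _)⟩, ?_⟩
      rw [Path.subpath_self, pathLabel_refl, walkProd, walkProd, gridLabel, gridLabel,
        segmentLabel_mul x hC (hball _) (hself 0) hmem (hself 0), segmentLabel_self, one_mul,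
        mul_one]
    | succ k ih =>
      obtain ⟨L, hL, hprod⟩ := ih
      have hC := convex_ball (γ (t k) : ℂ) (4 * δ)
      have hCΩ := hball (t k)
      have hd : dist (γ (t k) : ℂ) (γ (t (k + 1))) < δ := hstep k _ Set.right_mem_uIcc
      rw [Complex.dist_eq] at hd
      have hre := (Complex.abs_re_le_norm _).trans_lt hd
      have him := (Complex.abs_im_le_norm _).trans_lt hd
      rw [Complex.sub_re] at hre
      rw [Complex.sub_im] at him
      have hre' := hre
      have him' := him
      rw [abs_sub_comm] at hre' him'
      -- turn the corner at the point with the new first and the old second coordinate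
      set v := gridFloor δ (γ (t k)) with hv
      set w := gridFloor δ (γ (t (k + 1))) with hw
      have hvC : gridPoint δ v ∈ Metric.ball (γ (t k) : ℂ) (4 * δ) := hself k
      have huC : gridPoint δ (w.1, v.2) ∈ Metric.ball (γ (t k) : ℂ) (4 * δ) :=
        gridPoint_mem_ball (abs_sub_mul_floor_le hδ hre) (abs_sub_mul_floor_le hδ (by simpa))
      have hwC : gridPoint δ w ∈ Metric.ball (γ (t k) : ℂ) (4 * δ) :=
        gridPoint_mem_ball (abs_sub_mul_floor_le hδ hre) (abs_sub_mul_floor_le hδ him)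
      have e₁ : w.1 ≤ v.1 + 1 := floor_div_le_add_one hδ hre'
      have e₂ : v.1 ≤ w.1 + 1 := floor_div_le_add_one hδ hre
      have e₃ : w.2 ≤ v.2 + 1 := floor_div_le_add_one hδ him'
      have e₄ : v.2 ≤ w.2 + 1 := floor_div_le_add_one hδ him
      obtain ⟨L₁, hL₁, hp₁⟩ := exists_walk_extend x hC hCΩ hvC huC (by
        by_cases h : v.1 = w.1
        · exact .inl (Prod.ext h rfl)
        · exact .inr (.inr ⟨rfl, by dsimp only; omega⟩)) hL
      obtain ⟨L₂, hL₂, hp₂⟩ := exists_walk_extend x hC hCΩ huC hwC (by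
        by_cases h : v.2 = w.2
        · exact .inl (Prod.ext rfl h)
        · exact .inr (.inl ⟨rfl, by dsimp only; omega⟩)) hL₁
      refine ⟨L₂, hL₂, ?_⟩
      have hγk : (γ (t k) : ℂ) ∈ Metric.ball (γ (t k) : ℂ) (4 * δ) :=
        Metric.mem_ball_self (by linarith)
      have hγk1 : (γ (t (k + 1)) : ℂ) ∈ Metric.ball (γ (t k) : ℂ) (4 * δ) := by
        rw [Metric.mem_ball, dist_comm, Complex.dist_eq]; linarith
      have harc : pathLabel x (γ.subpath (t k) (t (k + 1))) =
          segmentLabel x (γ (t k)) (γ (t (k + 1))) := by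
        apply pathLabel_eq_segmentLabel x hC hCΩ
        intro s
        have hs : γ.subpath (t k) (t (k + 1)) s ∈ γ '' Set.uIcc (t k) (t (k + 1)) :=
          Path.range_subpath γ _ _ ▸ Set.mem_range_self s
        obtain ⟨s', hs', h⟩ := hs
        rw [← h, Metric.mem_ball, dist_comm]
        linarith [hstep k s' hs']
      rw [← pathLabel_congr ⟨Path.Homotopy.subpathTransSubpath γ (t 0) (t k) (t (k + 1))⟩,
        pathLabel_trans, harc, mul_assoc, segmentLabel_mul x hC hCΩ hγk hγk1 hwC,
        ← segmentLabel_mul x hC hCΩ hγk hvC hwC, ← mul_assoc, hprod, hp₂, hp₁,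
        gridLabel, gridLabel, mul_assoc, mul_assoc,
        segmentLabel_mul x hC hCΩ hvC huC hwC]
  obtain ⟨L, hL, hprod⟩ := hclaim (n + 1)
  have hγ01 : (γ (t (n + 1)) : ℂ) = γ (t 0) := by rw [ht0, htn, γ.source, γ.target]
  rw [hγ01] at hL hprod
  rw [walkProd_gridLabel_eq_one x hcut hδ hL, mul_one, mul_eq_right, ht0, htn,
    Path.subpath_zero_one, pathLabel_cast] at hprod
  exact hprod

end SimplyConnected

/-! ### The Cauchy kernel -/

section CauchyKernel

theorem integrableOn_ball_inv_norm_sub (ζ : ℂ) (R : ℝ) :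
    IntegrableOn (fun z => ‖z - ζ‖⁻¹) (Metric.ball ζ R) := by
  have h : IntegrableOn (fun z : ℂ => ‖z‖⁻¹) (Metric.ball 0 R) := by
    rw [integrableOn_fun_norm_addHaar volume (f := fun y => y⁻¹)]
    have : IntegrableOn (fun _ => (1 : ℝ)) (Set.Ioo 0 R) := by simp
    refine this.congr_fun (fun y hy => ?_) measurableSet_Ioo
    simp [hy.1.ne']
  have h' := ((measurePreserving_sub_right volume ζ).integrableOn_comp_preimage
    (MeasurableEquiv.subRight ζ).measurableEmbedding).2 h
  convert! h' using 1
  ext z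
  simp [dist_eq_norm]

theorem setIntegral_ball_inv_norm_sub (ζ : ℂ) {R : ℝ} (hR : 0 ≤ R) :
    ∫ z in Metric.ball ζ R, ‖z - ζ‖⁻¹ = 2 * Real.pi * R := by
  have h : ∫ z in Metric.ball (0 : ℂ) R, ‖z‖⁻¹ = 2 * Real.pi * R := by
    rw [← integral_indicator Metric.isOpen_ball.measurableSet]
    have e : (Metric.ball (0 : ℂ) R).indicator (fun z => ‖z‖⁻¹) =
        fun z => (Set.Iio R).indicator (fun y => y⁻¹) ‖z‖ := by
      ext z; simp [Set.indicator]
    rw [e, integral_fun_norm_addHaar volume ((Set.Iio R).indicator (fun y : ℝ => y⁻¹))]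
    have e2 : ∫ y in Set.Ioi (0 : ℝ), y ^ (Module.finrank ℝ ℂ - 1) •
        (Set.Iio R).indicator (fun y : ℝ => y⁻¹) y = R := by
      rw [setIntegral_congr_fun (g := (Set.Iio R).indicator fun _ => (1 : ℝ)) measurableSet_Ioi,
        setIntegral_indicator measurableSet_Iio, Set.Ioi_inter_Iio]
      · simp [hR]
      · intro y hy
        have : y ≠ 0 := (Set.mem_Ioi.1 hy).ne'
        by_cases h : y < R <;> simp [h, this]
    rw [e2]
    simp [Measure.real, Complex.volume_ball]
    ring
  have h' := (measurePreserving_sub_right volume ζ).setIntegral_preimage_emb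
    (MeasurableEquiv.subRight ζ).measurableEmbedding (fun z => ‖z‖⁻¹) (Metric.ball 0 R)
  rw [← h, ← h']
  congr 2
  ext z
  simp [dist_eq_norm]

theorem integrableOn_inv_norm_sub {A : Set ℂ} (hA : Bornology.IsBounded A) (ζ : ℂ) :
    IntegrableOn (fun z => ‖z - ζ‖⁻¹) A := by
  obtain ⟨R, hR⟩ := hA.subset_ball ζ
  exact (integrableOn_ball_inv_norm_sub ζ R).mono_set hR

/-- The unnormalized Cauchy transform `∫_A q(z) / (z - ζ) dA(z)` of the density `q` on `A`. -/
noncomputable def cauchyTransform (A : Set ℂ) (q : ℂ → ℂ) (ζ : ℂ) : ℂ :=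
  ∫ z in A, q z / (z - ζ)

variable {A : Set ℂ} {q : ℂ → ℂ}

theorem integrableOn_div_sub (hA : Bornology.IsBounded A) (hAm : MeasurableSet A)
    (hq : Continuous q) (ζ : ℂ) : IntegrableOn (fun z => q z / (z - ζ)) A := by
  obtain ⟨M, hM⟩ := hA.isCompact_closure.exists_bound_of_continuousOn hq.continuousOn
  refine Integrable.mono' ((integrableOn_inv_norm_sub hA ζ).const_mul M) ?_ ?_
  · exact (hq.measurable.div (measurable_id.sub_const ζ)).aestronglyMeasurable
  · filter_upwards [ae_restrict_mem hAm] with z hz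
    rw [norm_div, div_eq_mul_inv]
    gcongr
    exact hM z (subset_closure hz)

/-- The Cauchy kernel `1 / w`, replaced by the continuous function `conj w / δ²` on `‖w‖ < δ`. -/
noncomputable def truncatedKernel (δ : ℝ) (w : ℂ) : ℂ := conj w / ((max (‖w‖ ^ 2) (δ ^ 2) : ℝ) : ℂ)

theorem continuous_truncatedKernel {δ : ℝ} (hδ : 0 < δ) : Continuous (truncatedKernel δ) := by
  unfold truncatedKernel
  refine Continuous.div (by fun_prop) (by fun_prop) fun w => ?_
  have : 0 < max (‖w‖ ^ 2) (δ ^ 2) := lt_max_of_lt_right (by positivity)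
  exact_mod_cast this.ne'

theorem norm_truncatedKernel_le {δ : ℝ} (hδ : 0 < δ) (w : ℂ) : ‖truncatedKernel δ w‖ ≤ δ⁻¹ := by
  have h : 0 < max (‖w‖ ^ 2) (δ ^ 2) := lt_max_of_lt_right (by positivity)
  rw [truncatedKernel, norm_div, RCLike.norm_conj, Complex.norm_real, Real.norm_of_nonneg h.le,
    div_le_iff₀ h]
  rcases le_total ‖w‖ δ with h1 | h1
  · calc ‖w‖ ≤ δ := h1
      _ = δ⁻¹ * δ ^ 2 := by field_simp
      _ ≤ _ := by gcongr; exact le_max_right _ _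
  · calc ‖w‖ = δ⁻¹ * (δ * ‖w‖) := by field_simp
      _ ≤ δ⁻¹ * ‖w‖ ^ 2 := by rw [sq]; gcongr
      _ ≤ _ := by gcongr; exact le_max_left _ _

theorem truncatedKernel_eq_inv {δ : ℝ} (hδ : 0 < δ) {w : ℂ} (hw : δ ≤ ‖w‖) :
    truncatedKernel δ w = w⁻¹ := by
  rw [truncatedKernel, max_eq_left (by gcongr), Complex.inv_def, ← Complex.normSq_eq_norm_sq,
    div_eq_mul_inv]
  push_cast
  rfl

theorem norm_inv_sub_truncatedKernel_le {δ : ℝ} (hδ : 0 < δ) (w : ℂ) :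
    ‖w⁻¹ - truncatedKernel δ w‖ ≤ ‖w‖⁻¹ := by
  rcases eq_or_ne w 0 with rfl | hw
  · simp [truncatedKernel]
  have hn : 0 < ‖w‖ := norm_pos_iff.2 hw
  have h : 0 < max (‖w‖ ^ 2) (δ ^ 2) := lt_max_of_lt_right (by positivity)
  have e : w⁻¹ - truncatedKernel δ w = w⁻¹ * ((1 - ‖w‖ ^ 2 / max (‖w‖ ^ 2) (δ ^ 2) : ℝ) : ℂ) := by
    have : ((max (‖w‖ ^ 2) (δ ^ 2) : ℝ) : ℂ) ≠ 0 := by exact_mod_cast h.ne'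
    rw [truncatedKernel, ← Complex.normSq_eq_norm_sq] at *
    push_cast
    rw [← Complex.mul_conj]
    rw [mul_sub, mul_one, mul_div_assoc, inv_mul_cancel_left₀ hw]
  rw [e, norm_mul, norm_inv, Complex.norm_real]
  refine mul_le_of_le_one_right (by positivity) ?_
  have h1 : 0 ≤ ‖w‖ ^ 2 / max (‖w‖ ^ 2) (δ ^ 2) := by positivity
  have h2 : ‖w‖ ^ 2 / max (‖w‖ ^ 2) (δ ^ 2) ≤ 1 := (div_le_one h).2 (le_max_left _ _)
  rw [Real.norm_eq_abs, abs_le]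
  constructor <;> linarith

/-- The Cauchy transform of a bounded density of bounded support is continuous: it is a uniform
limit of integrals against truncated kernels. -/
theorem continuous_cauchyTransform (hA : Bornology.IsBounded A) (hAm : MeasurableSet A)
    (hq : Continuous q) : Continuous (cauchyTransform A q) := by
  obtain ⟨M, hM⟩ := hA.isCompact_closure.exists_bound_of_continuousOn hq.continuousOn
  obtain ⟨M, hM0, hM⟩ : ∃ M, 0 < M ∧ ∀ z ∈ A, ‖q z‖ ≤ M :=
    ⟨max M 1, by positivity, fun z hz => (hM z (subset_closure hz)).trans (le_max_left _ _)⟩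
  have hfin : IsFiniteMeasure (volume.restrict A) := ⟨by
    rw [Measure.restrict_apply_univ]; exact hA.measure_lt_top⟩
  have hcont : ∀ δ > 0, Continuous fun ζ => ∫ z in A, q z * truncatedKernel δ (z - ζ) := by
    intro δ hδ
    have hk := continuous_truncatedKernel hδ
    refine continuous_of_dominated (bound := fun _ => M * δ⁻¹) (fun ζ => ?_) (fun ζ => ?_)
      (integrable_const _) (.of_forall fun z => ?_)
    · exact (hq.mul (hk.comp (continuous_sub_right ζ))).aestronglyMeasurable
    · filter_upwards [ae_restrict_mem hAm] with z hz
      rw [norm_mul]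
      gcongr
      · exact hM z hz
      · exact norm_truncatedKernel_le hδ _
    · exact continuous_const.mul (hk.comp (continuous_const.sub continuous_id))
  refine continuous_of_uniform_approx_of_continuous fun u hu => ?_
  obtain ⟨ε, hε, hεu⟩ := Metric.mem_uniformity_dist.1 hu
  obtain ⟨δ, hδ, hδε⟩ : ∃ δ > 0, M * (2 * Real.pi * δ) < ε := by
    refine ⟨ε / (2 * (M * (2 * Real.pi))), by positivity, ?_⟩
    field_simp
    norm_num
  refine ⟨_, hcont δ hδ, fun ζ => hεu ?_⟩
  rw [dist_eq_norm, cauchyTransform]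
  have hi : IntegrableOn (fun z => q z * truncatedKernel δ (z - ζ)) A := by
    refine Integrable.mono' (integrable_const (M * δ⁻¹)) ?_ ?_
    · exact (hq.mul ((continuous_truncatedKernel hδ).comp
        (continuous_sub_right ζ))).aestronglyMeasurable
    · filter_upwards [ae_restrict_mem hAm] with z hz
      rw [norm_mul]
      gcongr
      · exact hM z hz
      · exact norm_truncatedKernel_le hδ _
  rw [← integral_sub (integrableOn_div_sub hA hAm hq ζ) hi]
  have hind : Integrable ((Metric.ball ζ δ).indicator fun z => M * ‖z - ζ‖⁻¹) :=
    (integrable_indicator_iff Metric.isOpen_ball.measurableSet).2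
      ((integrableOn_ball_inv_norm_sub ζ δ).const_mul M)
  refine lt_of_le_of_lt ?_ hδε
  calc ‖∫ z in A, (q z / (z - ζ) - q z * truncatedKernel δ (z - ζ))‖
      ≤ ∫ z in A, (Metric.ball ζ δ).indicator (fun z => M * ‖z - ζ‖⁻¹) z := by
        refine norm_integral_le_of_norm_le ?_ ?_
        · exact hind.integrableOn
        · filter_upwards [ae_restrict_mem hAm] with z hz
          rw [div_eq_mul_inv, ← mul_sub, norm_mul]
          by_cases hzb : z ∈ Metric.ball ζ δ
          · rw [Set.indicator_of_mem hzb]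
            gcongr
            · exact hM z hz
            · exact norm_inv_sub_truncatedKernel_le hδ _
          · rw [Set.indicator_of_notMem hzb, truncatedKernel_eq_inv hδ]
            · simp
            · simpa [dist_eq_norm] using hzb
    _ ≤ ∫ z, (Metric.ball ζ δ).indicator (fun z => M * ‖z - ζ‖⁻¹) z := by
        refine setIntegral_le_integral ?_ ?_
        · exact hind
        · exact .of_forall fun z => Set.indicator_nonneg (fun _ _ => by positivity) _
    _ = M * (2 * Real.pi * δ) := by
        rw [integral_indicator Metric.isOpen_ball.measurableSet, integral_const_mul,
          setIntegral_ball_inv_norm_sub ζ hδ.le]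

/-- The Cauchy transform is holomorphic off its support. -/
theorem differentiableAt_cauchyTransform (hA : Bornology.IsBounded A) (hAm : MeasurableSet A)
    (hq : Continuous q) {ζ : ℂ} {ε : ℝ} (hε : 0 < ε) (hd : Disjoint (Metric.ball ζ ε) A) :
    DifferentiableAt ℂ (cauchyTransform A q) ζ := by
  obtain ⟨M, hM⟩ := hA.isCompact_closure.exists_bound_of_continuousOn hq.continuousOn
  have hfin : IsFiniteMeasure (volume.restrict A) := ⟨by
    rw [Measure.restrict_apply_univ]; exact hA.measure_lt_top⟩
  have hfar : ∀ z ∈ A, ∀ x ∈ Metric.ball ζ (ε / 2), ε / 2 ≤ ‖z - x‖ := by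
    intro z hz x hx
    have h1 : ε ≤ dist z ζ := by
      by_contra! h
      exact Set.disjoint_left.1 hd (Metric.mem_ball.2 h) hz
    have h2 := dist_triangle z x ζ
    rw [← dist_eq_norm]
    linarith [Metric.mem_ball.1 hx]
  refine (hasDerivAt_integral_of_dominated_loc_of_deriv_le
    (F := fun ζ z => q z / (z - ζ)) (F' := fun ζ z => q z / (z - ζ) ^ 2)
    (bound := fun _ => M / (ε / 2) ^ 2) (Metric.ball_mem_nhds ζ (half_pos hε)) ?_ ?_ ?_ ?_
    (integrable_const _) ?_).2.differentiableAt
  · exact .of_forall fun x =>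
      (hq.measurable.div (measurable_id.sub_const x)).aestronglyMeasurable
  · exact integrableOn_div_sub hA hAm hq ζ
  · exact (hq.measurable.div ((measurable_id.sub_const ζ).pow_const 2)).aestronglyMeasurable
  · filter_upwards [ae_restrict_mem hAm] with z hz x hx
    have := hfar z hz x hx
    rw [norm_div, norm_pow]
    gcongr
    · exact (norm_nonneg _).trans (hM z (subset_closure hz))
    · exact hM z (subset_closure hz)
  · filter_upwards [ae_restrict_mem hAm] with z hz x hx
    have h1 : z - x ≠ 0 := norm_pos_iff.1 ((half_pos hε).trans_le (hfar z hz x hx))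
    have h2 := (((hasDerivAt_id x).const_sub z).inv h1).const_mul (q z)
    simp only [div_eq_mul_inv]
    convert! h2 using 1
    simp

end CauchyKernel

/-! ### The Cauchy transform of an antiholomorphic monomial on a disc -/

section Disc

/-- Integration in polar coordinates, in terms of the averages over circles. -/
theorem integral_eq_integral_circleAverage {f : ℂ → ℂ} (hm : Measurable f) (hf : Integrable f) :
    ∫ z, f z = ∫ r in Set.Ioi (0 : ℝ), ((2 * Real.pi * r : ℝ) : ℂ) * Real.circleAverage f 0 r := by
  have hsymm : Measurable fun p => Complex.polarCoord.symm p := by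
    simp only [Complex.polarCoord_symm_apply]
    fun_prop
  have hint : IntegrableOn (fun p : ℝ × ℝ => p.1 • f (Complex.polarCoord.symm p))
      (Set.Ioi 0 ×ˢ Set.Ioo (-Real.pi) Real.pi) (volume.prod volume) := by
    refine ⟨(measurable_fst.smul (hm.comp hsymm)).aestronglyMeasurable, ?_⟩
    have h := Complex.lintegral_comp_polarCoord_symm fun z => ‖f z‖ₑ
    rw [polarCoord_target, Measure.volume_eq_prod] at h
    rw [HasFiniteIntegral]
    refine lt_of_le_of_lt (le_of_eq ?_) (h.trans_lt hf.2)
    refine setLIntegral_congr_fun (measurableSet_Ioi.prod measurableSet_Ioo) fun p hp => ?_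
    have hp1 : (0 : ℝ) < p.1 := hp.1
    rw [enorm_smul, Real.enorm_eq_ofReal hp1.le, smul_eq_mul]
  rw [← Complex.integral_comp_polarCoord_symm, polarCoord_target, Measure.volume_eq_prod,
    setIntegral_prod _ hint]
  refine setIntegral_congr_fun measurableSet_Ioi fun r _ => ?_
  have hpi := Real.pi_pos
  dsimp only
  rw [Real.circleAverage_eq_integral_add (-Real.pi),
    intervalIntegral.integral_comp_add_right (fun θ => f (circleMap 0 r θ)), integral_smul,
    ← integral_Ioc_eq_integral_Ioo, ← intervalIntegral.integral_of_le (by linarith)]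
  have e : (2 * Real.pi + -Real.pi) = Real.pi := by ring
  have hpolar : ∀ θ, Complex.polarCoord.symm (r, θ) = circleMap 0 r θ := fun θ => by
    rw [Complex.polarCoord_symm_apply, circleMap, zero_add, Complex.exp_mul_I]
    push_cast
    rfl
  simp only [hpolar]
  rw [zero_add, e, Complex.real_smul, Complex.real_smul]
  push_cast
  have hpi0 : (Real.pi : ℂ) ≠ 0 := by exact_mod_cast hpi.ne'
  field_simp

theorem circleAverage_conj (f : ℂ → ℂ) (c : ℂ) (r : ℝ) :
    Real.circleAverage (fun z => conj (f z)) c r = conj (Real.circleAverage f c r) := by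
  rw [Real.circleAverage_def, Real.circleAverage_def,
    intervalIntegral.integral_of_le Real.two_pi_pos.le,
    intervalIntegral.integral_of_le Real.two_pi_pos.le, integral_conj]
  simp only [Complex.real_smul, map_mul, Complex.conj_ofReal]

/-- Circle averages of `conj z ^ k / (z - ζ)`: on the circle, `conj z = r ^ 2 / z`, and Cauchy's
formula applies to the complex conjugate. -/
theorem circleAverage_conj_pow_div_sub {r : ℝ} (hr : 0 < r) {ζ : ℂ} (k : ℕ) (hζ : ‖ζ‖ ≠ r) :
    Real.circleAverage (fun z => conj z ^ k / (z - ζ)) 0 r =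
      if r < ‖ζ‖ then -((r : ℂ) ^ (2 * k) / ζ ^ (k + 1)) else 0 := by
  have hr0 : (r : ℂ) ≠ 0 := by exact_mod_cast hr.ne'
  have key : Real.circleAverage (fun z => z ^ (k + 1) / ((r : ℂ) ^ 2 - conj ζ * z)) 0 r =
      if r < ‖ζ‖ then -(((r : ℂ) ^ 2) ^ k / conj ζ ^ (k + 1)) else 0 := by
    have hc : Real.circleAverage (fun z => z ^ (k + 1) / ((r : ℂ) ^ 2 - conj ζ * z)) 0 r =
        (2 * Real.pi * Complex.I)⁻¹ • ∮ z in C(0, r), z ^ k / ((r : ℂ) ^ 2 - conj ζ * z) := by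
      rw [Real.circleAverage_eq_circleIntegral hr.ne']
      congr 1
      refine circleIntegral.integral_congr hr.le fun z hz => ?_
      have hz0 : z ≠ 0 := ne_zero_of_mem_sphere hr.ne' ⟨z, hz⟩
      simp only [sub_zero, smul_eq_mul]
      rw [pow_succ']
      field_simp
    rw [hc]
    split_ifs with h
    · have hζ0 : conj ζ ≠ 0 := by
        rw [Ne, map_eq_zero]; rintro rfl; simp at h; linarith
      have ha : (r : ℂ) ^ 2 / conj ζ ∈ Metric.ball (0 : ℂ) r := by
        rw [mem_ball_zero_iff, norm_div, norm_pow, RCLike.norm_conj, Complex.norm_real,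
          Real.norm_of_nonneg hr.le, div_lt_iff₀ (hr.trans h), sq]
        gcongr
      have hd : DiffContOnCl ℂ (fun z : ℂ => -(z ^ k / conj ζ)) (Metric.ball 0 r) := by
        refine Differentiable.diffContOnCl ?_
        fun_prop
      have := hd.circleIntegral_sub_inv_smul ha
      rw [circleIntegral.integral_congr (g := fun z => (z - (r : ℂ) ^ 2 / conj ζ)⁻¹ •
        -(z ^ k / conj ζ)) hr.le, this, smul_smul, inv_mul_cancel₀ Complex.two_pi_I_ne_zero,
        one_smul, div_pow, pow_succ (conj ζ), div_div]
      intro z hz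
      have h1 : (r : ℂ) ^ 2 - conj ζ * z = -(conj ζ * (z - (r : ℂ) ^ 2 / conj ζ)) := by
        field_simp; ring
      simp only [h1, smul_eq_mul]
      rw [div_neg, mul_neg, ← div_div, div_eq_inv_mul _ (z - _)]
    · have hd : DiffContOnCl ℂ (fun z : ℂ => z ^ k / ((r : ℂ) ^ 2 - conj ζ * z))
          (Metric.ball 0 r) := by
        refine DifferentiableOn.diffContOnCl fun z hz => ?_
        have hz : ‖z‖ ≤ r := by
          rw [closure_ball _ hr.ne'] at hz
          simpa using hz
        have hlt : ‖ζ‖ < r := lt_of_le_of_ne (not_lt.1 h) hζ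
        have hne : (r : ℂ) ^ 2 - conj ζ * z ≠ 0 := by
          intro h0
          have h1 := congrArg norm (sub_eq_zero.1 h0)
          rw [norm_pow, norm_mul, RCLike.norm_conj, Complex.norm_real,
            Real.norm_of_nonneg hr.le] at h1
          nlinarith [norm_nonneg ζ, norm_nonneg z]
        exact (by fun_prop (disch := exact hne) : DifferentiableAt ℂ
          (fun z : ℂ => z ^ k / ((r : ℂ) ^ 2 - conj ζ * z)) z).differentiableWithinAt
      rw [hd.circleIntegral_eq_zero hr.le, smul_zero]
  have h := congrArg conj key
  rw [← circleAverage_conj] at h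
  have h2 : Real.circleAverage (fun z => conj z ^ k / (z - ζ)) 0 r = Real.circleAverage
      (fun z => conj (z ^ (k + 1) / ((r : ℂ) ^ 2 - conj ζ * z))) 0 r := by
    refine Real.circleAverage_congr_sphere fun z hz => ?_
    rw [abs_of_pos hr] at hz
    have hz0 : z ≠ 0 := ne_zero_of_mem_sphere hr.ne' ⟨z, hz⟩
    have hzr : (r : ℂ) ^ 2 = z * conj z := by
      rw [Complex.mul_conj, Complex.normSq_eq_norm_sq, mem_sphere_zero_iff_norm.1 hz]
      push_cast; rfl
    have hcz : conj z ≠ 0 := by simpa using hz0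
    simp only [hzr, map_div₀, map_pow, map_sub, map_mul, Complex.conj_conj]
    rw [show conj z * z - ζ * conj z = conj z * (z - ζ) by ring, pow_succ',
      mul_div_mul_left _ _ hcz]
  rw [h2, h]
  split_ifs
  · simp [pow_mul]
  · simp

theorem cauchyTransform_conj_pow_ball {ρ : ℝ} {ζ : ℂ} (hζ : ‖ζ‖ < ρ) (k : ℕ) :
    cauchyTransform (Metric.ball 0 ρ) (fun z => conj z ^ k) ζ =
      -(Real.pi * conj ζ ^ (k + 1) / (k + 1)) := by
  have hm : MeasurableSet (Metric.ball (0 : ℂ) ρ) := Metric.isOpen_ball.measurableSet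
  have hcm : Measurable fun z : ℂ => conj z := Complex.continuous_conj.measurable
  have hρ : 0 < ρ := (norm_nonneg _).trans_lt hζ
  rw [cauchyTransform, ← integral_indicator hm, integral_eq_integral_circleAverage]
  rotate_left
  · exact ((hcm.pow_const k).div (measurable_id.sub_const ζ)).indicator hm
  · exact (integrable_indicator_iff hm).2 (integrableOn_div_sub Metric.isBounded_ball hm
      (by fun_prop) ζ)
  have hrad : ∀ᵐ r ∂volume.restrict (Set.Ioi (0 : ℝ)), ((2 * Real.pi * r : ℝ) : ℂ) *
      Real.circleAverage ((Metric.ball 0 ρ).indicator fun z => conj z ^ k / (z - ζ)) 0 r =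
      (Set.Ioo 0 ‖ζ‖).indicator
        (fun r : ℝ => -(2 * Real.pi / ζ ^ (k + 1)) * ((r ^ (2 * k + 1) : ℝ) : ℂ)) r := by
    filter_upwards [ae_restrict_mem measurableSet_Ioi,
      ae_restrict_of_ae (Measure.ae_ne volume ‖ζ‖)] with r hr hne
    have hr : 0 < r := hr
    by_cases hrρ : r < ρ
    · have e : Real.circleAverage ((Metric.ball 0 ρ).indicator fun z => conj z ^ k / (z - ζ)) 0 r =
          Real.circleAverage (fun z => conj z ^ k / (z - ζ)) 0 r := by
        refine Real.circleAverage_congr_sphere fun z hz => Set.indicator_of_mem ?_ _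
        rw [abs_of_pos hr, mem_sphere_zero_iff_norm] at hz
        simpa [hz] using hrρ
      rw [e, circleAverage_conj_pow_div_sub hr k hne.symm]
      by_cases h : r < ‖ζ‖
      · rw [if_pos h, Set.indicator_of_mem (show r ∈ Set.Ioo 0 ‖ζ‖ from ⟨hr, h⟩)]
        push_cast
        ring
      · rw [if_neg h, Set.indicator_of_notMem fun h' => h h'.2, mul_zero]
    · have e : Real.circleAverage ((Metric.ball 0 ρ).indicator fun z => conj z ^ k / (z - ζ)) 0 r =
          Real.circleAverage (fun _ => (0 : ℂ)) 0 r := by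
        refine Real.circleAverage_congr_sphere fun z hz => Set.indicator_of_notMem ?_ _
        rw [abs_of_pos hr, mem_sphere_zero_iff_norm] at hz
        simpa [hz] using hrρ
      rw [e, Set.indicator_of_notMem fun h' => hrρ (h'.2.trans hζ)]
      simp [Real.circleAverage_def]
  rw [integral_congr_ae hrad, setIntegral_indicator measurableSet_Ioo,
    Set.inter_eq_right.2 Set.Ioo_subset_Ioi_self, integral_const_mul, integral_complex_ofReal,
    ← integral_Ioc_eq_integral_Ioo, ← intervalIntegral.integral_of_le (norm_nonneg _),
    integral_pow]
  rcases eq_or_ne ζ 0 with rfl | hζ0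
  · simp
  have h1 : ((k : ℂ) + 1) ≠ 0 := by exact_mod_cast k.succ_ne_zero
  have h2 : ((‖ζ‖ : ℝ) : ℂ) ^ (2 * k + 1 + 1) = (ζ * conj ζ) ^ (k + 1) := by
    rw [Complex.mul_conj, Complex.normSq_eq_norm_sq, show 2 * k + 1 + 1 = 2 * (k + 1) by ring,
      pow_mul]
    push_cast; rfl
  push_cast
  rw [h2]
  have h3 : (2 * (k : ℂ) + 1 + 1) ≠ 0 := by
    rw [show (2 * (k : ℂ) + 1 + 1) = 2 * (k + 1) by ring]
    exact mul_ne_zero two_ne_zero h1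
  rw [mul_pow]
  field_simp
  simp
  ring

end Disc

/-! ### The Cauchy transform inside `Ω` -/

section LocalForm

variable {A : Set ℂ} {q q' : ℂ → ℂ}

theorem cauchyTransform_add (hA : Bornology.IsBounded A) (hAm : MeasurableSet A)
    (hq : Continuous q) (hq' : Continuous q') (ζ : ℂ) :
    cauchyTransform A (fun z => q z + q' z) ζ = cauchyTransform A q ζ + cauchyTransform A q' ζ := by
  simp only [cauchyTransform, add_div]
  exact integral_add (integrableOn_div_sub hA hAm hq ζ) (integrableOn_div_sub hA hAm hq' ζ)

theorem cauchyTransform_const_mul (A : Set ℂ) (q : ℂ → ℂ) (c ζ : ℂ) :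
    cauchyTransform A (fun z => c * q z) ζ = c * cauchyTransform A q ζ := by
  simp only [cauchyTransform, mul_div_assoc]
  exact integral_const_mul _ _

theorem cauchyTransform_ball_eq_translate (q : ℂ → ℂ) (z₀ ζ : ℂ) (ρ : ℝ) :
    cauchyTransform (Metric.ball z₀ ρ) q ζ =
      cauchyTransform (Metric.ball 0 ρ) (fun z => q (z + z₀)) (ζ - z₀) := by
  have h := (measurePreserving_add_right volume z₀).setIntegral_preimage_emb
    (MeasurableEquiv.addRight z₀).measurableEmbedding (fun z => q z / (z - ζ)) (Metric.ball z₀ ρ)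
  rw [cauchyTransform, cauchyTransform, ← h]
  congr 2
  · ext z
    simp [dist_eq_norm]
  · ext z
    congr 1
    ring

/-- On a disc, the Cauchy transform of `conj (P')` is `-π conj P`, up to a constant. -/
theorem cauchyTransform_conj_derivative_ball {ρ : ℝ} {ζ : ℂ} (hζ : ‖ζ‖ < ρ) (P : ℂ[X]) :
    cauchyTransform (Metric.ball 0 ρ) (fun z => conj ((derivative P).eval z)) ζ =
      -(Real.pi * conj (P.eval ζ - P.eval 0)) := by
  induction P using Polynomial.induction_on' with
  | add P Q hP hQ =>
    simp only [eval_add, map_add]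
    rw [cauchyTransform_add Metric.isBounded_ball Metric.isOpen_ball.measurableSet (by fun_prop)
      (by fun_prop), hP, hQ]
    simp only [map_sub, map_add]
    ring
  | monomial n a =>
    rcases n with _ | k
    · simp [cauchyTransform]
    · have h := cauchyTransform_conj_pow_ball hζ k
      have h1 : ((k : ℂ) + 1) ≠ 0 := by exact_mod_cast k.succ_ne_zero
      simp only [derivative_monomial, eval_monomial, map_mul, map_pow, add_tsub_cancel_right]
      rw [cauchyTransform_const_mul, h]
      simp
      field_simp

/-- On a disc, the Cauchy transform of `z` is `-π |ζ|²`, up to a constant. -/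
theorem cauchyTransform_id_ball {ρ : ℝ} {ζ : ℂ} (hζ : ‖ζ‖ < ρ) :
    cauchyTransform (Metric.ball 0 ρ) (fun z => z) ζ =
      (∫ _ in Metric.ball (0 : ℂ) ρ, (1 : ℂ)) - Real.pi * (ζ * conj ζ) := by
  have h := cauchyTransform_conj_pow_ball hζ 0
  simp only [pow_zero, zero_add, pow_one, CharP.cast_eq_zero, div_one] at h
  have h2 : cauchyTransform (Metric.ball 0 ρ) (fun z => z) ζ =
      (∫ _ in Metric.ball (0 : ℂ) ρ, (1 : ℂ)) +
        ζ * cauchyTransform (Metric.ball 0 ρ) (fun _ => 1) ζ := by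
    rw [cauchyTransform, cauchyTransform, ← integral_const_mul, ← integral_add]
    · refine integral_congr_ae ?_
      filter_upwards [ae_restrict_of_ae (Measure.ae_ne volume ζ)] with z hz
      have : z - ζ ≠ 0 := sub_ne_zero.2 hz
      field_simp
      ring
    · exact integrableOn_const Metric.isBounded_ball.measure_lt_top.ne
    · exact (integrableOn_div_sub Metric.isBounded_ball Metric.isOpen_ball.measurableSet
        continuous_const ζ).const_mul ζ
  rw [h2, h]
  ring

/-- Inside `Ω`, the Cauchy transform of `z - conj (P' z)` satisfies
`∂̄(φ / π + |z|² - conj P) = 0`. -/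
theorem differentiableOn_cauchyTransform_add {Ω : Set ℂ} (hopen : IsOpen Ω)
    (hbdd : Bornology.IsBounded Ω) (P : ℂ[X]) :
    DifferentiableOn ℂ (fun ζ => cauchyTransform Ω (fun z => z - conj ((derivative P).eval z)) ζ
      / Real.pi + ζ * conj ζ - conj (P.eval ζ)) Ω := by
  intro z₀ hz₀
  set q : ℂ → ℂ := fun z => z - conj ((derivative P).eval z) with hq
  have hqc : Continuous q := by fun_prop
  obtain ⟨ρ, hρ, hball⟩ := Metric.isOpen_iff.1 hopen z₀ hz₀
  have hbm : MeasurableSet (Metric.ball z₀ ρ) := Metric.isOpen_ball.measurableSet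
  have hdiffm : MeasurableSet (Ω \ Metric.ball z₀ ρ) := hopen.measurableSet.diff hbm
  have hpi : (Real.pi : ℂ) ≠ 0 := by exact_mod_cast Real.pi_ne_zero
  -- the contribution of the disc around `z₀`
  have hdisc : ∀ ζ ∈ Metric.ball z₀ ρ, cauchyTransform (Metric.ball z₀ ρ) q ζ =
      (∫ _ in Metric.ball (0 : ℂ) ρ, (1 : ℂ)) - Real.pi * (ζ * conj (ζ - z₀)) +
        Real.pi * conj (P.eval ζ - P.eval z₀) := by
    intro ζ hζ
    have hζ' : ‖ζ - z₀‖ < ρ := by rwa [← dist_eq_norm]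
    have h0 := cauchyTransform_conj_pow_ball hζ' 0
    simp only [pow_zero, zero_add, pow_one, CharP.cast_eq_zero, div_one] at h0
    have hP := cauchyTransform_conj_derivative_ball hζ' (P.comp (X + C z₀))
    have e : (fun z => q (z + z₀)) = fun z => z + (z₀ * 1 +
        (-1) * conj ((derivative (P.comp (X + C z₀))).eval z)) := by
      ext z
      simp only [hq, derivative_comp, eval_mul, eval_comp]
      simp
      ring
    rw [cauchyTransform_ball_eq_translate, e, cauchyTransform_add Metric.isBounded_ball
      Metric.isOpen_ball.measurableSet (by fun_prop) (by fun_prop),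
      cauchyTransform_add Metric.isBounded_ball Metric.isOpen_ball.measurableSet (by fun_prop)
      (by fun_prop), cauchyTransform_const_mul, cauchyTransform_const_mul, h0, hP,
      cauchyTransform_id_ball hζ']
    simp
    ring
  have hloc : ∀ ζ ∈ Metric.ball z₀ ρ, cauchyTransform Ω q ζ / Real.pi + ζ * conj ζ -
      conj (P.eval ζ) = (cauchyTransform (Ω \ Metric.ball z₀ ρ) q ζ +
        (∫ _ in Metric.ball (0 : ℂ) ρ, (1 : ℂ))) / Real.pi + ζ * conj z₀ - conj (P.eval z₀) := by
    intro ζ hζ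
    have hsplit : cauchyTransform Ω q ζ = cauchyTransform (Metric.ball z₀ ρ) q ζ +
        cauchyTransform (Ω \ Metric.ball z₀ ρ) q ζ := by
      have hi := integrableOn_div_sub hbdd hopen.measurableSet hqc ζ
      rw [cauchyTransform, cauchyTransform, cauchyTransform,
        ← setIntegral_union Set.disjoint_sdiff_right hdiffm (hi.mono_set hball)
          (hi.mono_set Set.sdiff_subset), Set.union_sdiff_cancel hball]
    rw [hsplit, hdisc ζ hζ]
    simp only [map_sub]
    field_simp
    ring
  have hd : DifferentiableAt ℂ (fun ζ => (cauchyTransform (Ω \ Metric.ball z₀ ρ) q ζ +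
      (∫ _ in Metric.ball (0 : ℂ) ρ, (1 : ℂ))) / Real.pi + ζ * conj z₀ - conj (P.eval z₀)) z₀ := by
    have := differentiableAt_cauchyTransform (hbdd.subset Set.sdiff_subset) hdiffm hqc hρ
      Set.disjoint_sdiff_right
    fun_prop
  refine (hd.congr_of_eventuallyEq ?_).differentiableWithinAt
  filter_upwards [Metric.ball_mem_nhds z₀ hρ] with ζ hζ using hloc ζ hζ

end LocalForm

/-! ### Orthogonality -/

section Orthogonality

/-- The error of the best approximation is orthogonal to the Bergman space. -/
theorem IsBestBergmanApprox.integral_eq_zero {Ω : Set ℂ} {h f g : ℂ → ℂ}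
    (hh : MemLp h 2 (volume.restrict Ω)) (hf : IsBestBergmanApprox Ω h f)
    (hg : g ∈ bergmanSpace Ω) : ∫ z in Ω, conj (h z - f z) * g z = 0 := by
  have hgL : MemLp g 2 (volume.restrict Ω) := hg.2
  have hu := hh.sub hf.1.2
  set u := hu.toLp _ with hu_def
  set G := hgL.toLp _ with hG_def
  have hle : ∀ w ∈ Submodule.span ℂ {G}, ‖u‖ ≤ ‖u - w‖ := by
    intro w hw
    obtain ⟨c, rfl⟩ := Submodule.mem_span_singleton.1 hw
    have h1 := hf.2 (fun z => f z + c * g z)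
      ⟨hf.1.1.add (hg.1.const_mul c), hf.1.2.add (hg.2.const_mul c)⟩
    have e : u - c • G = (hu.sub (hgL.const_smul c)).toLp _ := by
      rw [MemLp.toLp_sub hu (hgL.const_smul c), MemLp.toLp_const_smul]
    rw [e, hu_def, Lp.norm_toLp, Lp.norm_toLp]
    refine ENNReal.toReal_mono (hu.sub (hgL.const_smul c)).2.ne ?_
    convert! h1 using 2
    ext z
    simp only [Pi.sub_apply, Pi.smul_apply, smul_eq_mul]
    ring
  have h0 := (Submodule.norm_eq_iInf_iff_inner_eq_zero (Submodule.span ℂ {G}) (u := u)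
    (Submodule.zero_mem _)).1 (by
      rw [sub_zero]
      refine le_antisymm (le_ciInf fun w => hle w w.2) ?_
      refine (ciInf_le ⟨0, ?_⟩ (0 : Submodule.span ℂ {G})).trans (by simp)
      rintro _ ⟨w, rfl⟩
      positivity) G (Submodule.mem_span_singleton_self G)
  rw [sub_zero, L2.inner_def] at h0
  rw [← h0]
  refine integral_congr_ae ?_
  filter_upwards [hu.coeFn_toLp, hgL.coeFn_toLp] with z hz hz'
  rw [hu_def, hG_def, hz, hz', RCLike.inner_apply, mul_comm]
  rfl

theorem memLp_conj {Ω : Set ℂ} (hΩ : MeasurableSet Ω) (hbdd : Bornology.IsBounded Ω) :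
    MemLp (fun z : ℂ => conj z) 2 (volume.restrict Ω) := by
  have hfin : IsFiniteMeasure (volume.restrict Ω) := ⟨by
    rw [Measure.restrict_apply_univ]; exact hbdd.measure_lt_top⟩
  obtain ⟨M, hM⟩ := hbdd.exists_norm_le
  refine MemLp.of_bound Complex.continuous_conj.aestronglyMeasurable M ?_
  filter_upwards [ae_restrict_mem hΩ] with z hz
  rw [RCLike.norm_conj]
  exact hM z hz

end Orthogonality

/-! ### Fine chains in a continuum -/

section Chains

/-- Consecutive points of an `ε`-chain in `T`. -/
def ChainStep {X : Type*} [PseudoMetricSpace X] (T : Set X) (ε : ℝ) (a b : X) : Prop :=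
  a ∈ T ∧ b ∈ T ∧ dist a b < ε

variable {X : Type*} [PseudoMetricSpace X]

theorem IsPreconnected.chain {K : Set X} (hK : IsPreconnected K) {ε : ℝ} (hε : 0 < ε) {a b : X}
    (ha : a ∈ K) (hb : b ∈ K) : Relation.ReflTransGen (ChainStep K ε) a b := by
  refine hK.induction₂' (Relation.ReflTransGen (ChainStep K ε)) (fun x hx => ?_)
    (fun x y z _ _ _ h h' => h.trans h') ha hb
  filter_upwards [self_mem_nhdsWithin, mem_nhdsWithin_of_mem_nhds (Metric.ball_mem_nhds x hε)]
    with y hy hxy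
  exact ⟨.single ⟨hx, hy, by rw [dist_comm]; exact hxy⟩, .single ⟨hy, hx, hxy⟩⟩

/-- An `ε`-chain that leaves a ball can be stopped close to the boundary of the ball. -/
theorem exists_chain_in_closedBall {E : Set X} {ε r : ℝ} {a b : X} (hr : 0 ≤ r) (ha : a ∈ E)
    (hb : r < dist b a) (hab : Relation.ReflTransGen (ChainStep E ε) a b) :
    ∃ y ∈ E ∩ Metric.closedBall a r, r - ε < dist y a ∧
      Relation.ReflTransGen (ChainStep (E ∩ Metric.closedBall a r) ε) a y := by
  have h : (b ∈ E ∩ Metric.closedBall a r ∧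
      Relation.ReflTransGen (ChainStep (E ∩ Metric.closedBall a r) ε) a b) ∨
      ∃ y ∈ E ∩ Metric.closedBall a r, r - ε < dist y a ∧
        Relation.ReflTransGen (ChainStep (E ∩ Metric.closedBall a r) ε) a y := by
    clear hb
    induction hab with
    | refl => exact .inl ⟨⟨ha, Metric.mem_closedBall_self hr⟩, .refl⟩
    | @tail b c _ hbc ih =>
      rcases ih with ⟨hbT, hab⟩ | h
      · by_cases hc : dist c a ≤ r
        · have hcT : c ∈ E ∩ Metric.closedBall a r := ⟨hbc.2.1, hc⟩
          exact .inl ⟨hcT, hab.tail ⟨hbT, hcT, hbc.2.2⟩⟩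
        · refine .inr ⟨b, hbT, ?_, hab⟩
          have := dist_triangle c b a
          rw [dist_comm c b] at this
          linarith [hbc.2.2]
      · exact .inr h
  rcases h with ⟨hbT, -⟩ | h
  · exact absurd hbT.2 (not_le.2 hb)
  · exact h

theorem ChainStep.mono {T : Set X} {ε ε' : ℝ} (h : ε ≤ ε') {a b : X} (hab : ChainStep T ε a b) :
    ChainStep T ε' a b := ⟨hab.1, hab.2.1, hab.2.2.trans_le h⟩

/-- A closed set in which the component of `a` is not a point contains, for each small `r`, a point
at distance `r` from `a` that can be joined to `a` by arbitrarily fine chains in the closed ball of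
radius `r`. -/
theorem exists_dist_eq_forall_chain [ProperSpace X] {E K : Set X} (hE : IsClosed E)
    (hKE : K ⊆ E) (hK : IsPreconnected K) {a b : X} (ha : a ∈ K) (hb : b ∈ K) {r : ℝ} (hr : 0 < r)
    (hrb : r < dist b a) :
    ∃ y ∈ E, dist y a = r ∧
      ∀ ε > 0, Relation.ReflTransGen (ChainStep (E ∩ Metric.closedBall a r) ε) a y := by
  have hT : IsCompact (E ∩ Metric.closedBall a r) := (isCompact_closedBall a r).inter_left hE
  have h (n : ℕ) := exists_chain_in_closedBall (ε := 1 / ((n : ℝ) + 1)) hr.le (hKE ha) hrb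
    (Relation.ReflTransGen.mono (fun x y hxy => ⟨hKE hxy.1, hKE hxy.2.1, hxy.2.2⟩)
      _ _ (hK.chain (by positivity) ha hb))
  choose y hyT hyd hyc using h
  obtain ⟨y₀, hy₀, φ, hφ, hlim⟩ := hT.tendsto_subseq hyT
  have hε : Filter.Tendsto (fun n => 1 / ((φ n : ℝ) + 1)) Filter.atTop (nhds 0) :=
    tendsto_one_div_add_atTop_nhds_zero_nat.comp hφ.tendsto_atTop
  refine ⟨y₀, hy₀.1, le_antisymm hy₀.2 ?_, fun ε hεpos => ?_⟩
  · refine le_of_tendsto_of_tendsto' (b := Filter.atTop)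
      (by simpa only [sub_zero] using (tendsto_const_nhds (x := r)).sub hε)
      (hlim.dist tendsto_const_nhds)
      fun n => (hyd (φ n)).le
  · obtain ⟨n, hn, hn'⟩ := ((hε.eventually (gt_mem_nhds hεpos)).and
      (hlim.eventually (Metric.ball_mem_nhds y₀ hεpos))).exists
    exact (Relation.ReflTransGen.mono (fun x z hxz => hxz.mono hn.le) _ _
      (hyc (φ n))).tail ⟨hyT _, hy₀, hn'⟩

end Chains

/-! ### Square roots with branch points in a continuum -/

section SquareRoot

theorem log_div_of_re_pos {x y : ℂ} (hx : 0 < x.re) (hy : 0 < y.re) :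
    Complex.log (x / y) = Complex.log x - Complex.log y := by
  have hx0 : x ≠ 0 := by rintro rfl; simp at hx
  have hy0 : y ≠ 0 := by rintro rfl; simp at hy
  have h1 := abs_lt.1 (Complex.abs_arg_lt_pi_div_two_iff.2 (.inl hx))
  have h2 := abs_lt.1 (Complex.abs_arg_lt_pi_div_two_iff.2 (.inl hy))
  have h3 : y.arg ≠ Real.pi := by linarith [Real.pi_pos]
  rw [div_eq_mul_inv, Complex.log_mul hx0 (inv_ne_zero hy0), Complex.log_inv _ h3, sub_eq_add_neg]
  rw [Complex.arg_inv, if_neg h3]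
  constructor <;> linarith

theorem re_div_pos_of_norm_sub_lt {x y : ℂ} (h : ‖x - y‖ < ‖y‖) : 0 < (x / y).re := by
  have hy : 0 < ‖y‖ := (norm_nonneg _).trans_lt h
  have hy0 : y ≠ 0 := norm_pos_iff.1 hy
  have h1 : ‖x / y - 1‖ < 1 := by
    rw [div_sub_one hy0, norm_div, div_lt_one hy]
    exact h
  have h2 := (abs_lt.1 ((Complex.abs_re_le_norm _).trans_lt h1)).1
  simp only [Complex.sub_re, Complex.one_re] at h2
  linarith

/-- A branch of `√((z - a) / (z - b))`, off the `ε`-neighbourhood of `T`, as the product of the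
principal branches for the links of an `ε`-chain in `T` from `a` to `b`. Far away from `T`, the
product telescopes. -/
theorem exists_sqrt_of_chain {T : Set ℂ} {a b c : ℂ} {r ε : ℝ} (hT : T ⊆ Metric.closedBall c r)
    (ha : a ∈ T) (hab : Relation.ReflTransGen (ChainStep T ε) a b) :
    ∃ S : ℂ → ℂ, (∀ z, (∀ w ∈ T, ε ≤ ‖z - w‖) → z ∉ T →
        DifferentiableAt ℂ S z ∧ S z ^ 2 = (z - a) / (z - b)) ∧
      ∀ z, 2 * r < ‖z - c‖ →
        S z = Complex.exp ((Complex.log ((z - a) / (z - c)) - Complex.log ((z - b) / (z - c))) / 2)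
      := by
  induction hab with
  | refl =>
    refine ⟨fun _ => 1, fun z _ hz => ⟨differentiableAt_const _, ?_⟩, fun z _ => by simp⟩
    have : z - a ≠ 0 := sub_ne_zero.2 fun h => hz (h ▸ ha)
    rw [one_pow, div_self this]
  | @tail b d _ hbd ih =>
    obtain ⟨S, hS, hfar⟩ := ih
    refine ⟨fun z => S z * Complex.exp (Complex.log ((z - b) / (z - d)) / 2),
      fun z hz hzT => ?_, fun z hz => ?_⟩
    · obtain ⟨hd, hsq⟩ := hS z hz hzT
      have hb0 : z - b ≠ 0 := sub_ne_zero.2 fun h => hzT (h ▸ hbd.1)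
      have hd0 : z - d ≠ 0 := sub_ne_zero.2 fun h => hzT (h ▸ hbd.2.1)
      have hre : 0 < ((z - b) / (z - d)).re := by
        apply re_div_pos_of_norm_sub_lt
        rw [show z - b - (z - d) = d - b by ring, ← dist_eq_norm, dist_comm]
        exact hbd.2.2.trans_le (hz d hbd.2.1)
      have hslit : (z - b) / (z - d) ∈ Complex.slitPlane := .inl hre
      constructor
      · have : DifferentiableAt ℂ (fun z => (z - b) / (z - d)) z := by
          fun_prop (disch := exact hd0)
        exact hd.mul ((this.clog hslit).div_const 2).cexp
      · rw [mul_pow, hsq, ← Complex.exp_nat_mul, Nat.cast_ofNat, mul_div_cancel₀ _ two_ne_zero,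
          Complex.exp_log (div_ne_zero hb0 hd0), div_mul_div_cancel₀ hb0]
    · have hr : ∀ w ∈ T, 0 < ((z - w) / (z - c)).re := by
        intro w hw
        apply re_div_pos_of_norm_sub_lt
        have := hT hw
        rw [Metric.mem_closedBall, dist_eq_norm] at this
        rw [show z - w - (z - c) = -(w - c) by ring, norm_neg]
        linarith [norm_nonneg (w - c)]
      have hc0 : z - c ≠ 0 := by
        have h1 := hr b hbd.1
        intro h
        simp [h] at h1
      dsimp only
      rw [hfar z hz, ← Complex.exp_add, ← div_div_div_cancel_right₀ hc0 (z - b) (z - d),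
        log_div_of_re_pos (hr b hbd.1) (hr d hbd.2.1)]
      congr 1
      ring

open Classical in
/-- The limit along `u` of a sequence that is constant on a set of `u`, with value `0` for other
sequences. -/
noncomputable def eventualValue (u : Ultrafilter ℕ) (s : ℕ → ℂ) : ℂ :=
  if h : ∃ c, ∀ᶠ n in u, s n = c then h.choose else 0

theorem eventualValue_eq {u : Ultrafilter ℕ} {s : ℕ → ℂ} {c : ℂ} (h : ∀ᶠ n in u, s n = c) :
    eventualValue u s = c := by
  have hex : ∃ c, ∀ᶠ n in u, s n = c := ⟨c, h⟩
  rw [eventualValue, dif_pos hex]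
  obtain ⟨n, h1, h2⟩ := (hex.choose_spec.and h).exists
  rw [← h1, h2]

/-- If `a` and `b` are joined by arbitrarily fine chains in the closed set `T`, there is a
holomorphic branch of `√((z - a) / (z - b))` off `T`. The branches given by finer and finer chains
need not agree, but locally they agree up to sign, so that they stabilize along an ultrafilter. -/
theorem exists_sqrt_of_forall_chain {T : Set ℂ} (hTc : IsClosed T) {a b : ℂ} {r : ℝ}
    (hT : T ⊆ Metric.closedBall a r) (ha : a ∈ T) (hbT : b ∈ T)
    (hab : ∀ ε > 0, Relation.ReflTransGen (ChainStep T ε) a b) :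
    ∃ S : ℂ → ℂ, DifferentiableOn ℂ S Tᶜ ∧ (∀ z ∉ T, S z ^ 2 = (z - a) / (z - b)) ∧
      ∀ z, 2 * r < ‖z - a‖ → S z = Complex.exp (-Complex.log ((z - b) / (z - a)) / 2) := by
  have h (n : ℕ) := exists_sqrt_of_chain (ε := 1 / ((n : ℝ) + 1)) hT ha (hab _ (by positivity))
  choose S hS hfar using h
  set u : Ultrafilter ℕ := Filter.hyperfilter ℕ with hu
  have hloc : ∀ z₀ ∉ T, ∃ R : ℂ → ℂ, ∃ ρ > 0, DifferentiableOn ℂ R (Metric.ball z₀ ρ) ∧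
      ∀ z ∈ Metric.ball z₀ ρ, eventualValue u (fun n => S n z) = R z ∧
        R z ^ 2 = (z - a) / (z - b) := by
    intro z₀ hz₀
    obtain ⟨δ, hδ, hball⟩ := Metric.isOpen_iff.1 hTc.isOpen_compl z₀ hz₀
    obtain ⟨N, hN⟩ := exists_nat_one_div_lt (half_pos hδ)
    have hgood : ∀ n ≥ N, ∀ z ∈ Metric.ball z₀ (δ / 2),
        DifferentiableAt ℂ (S n) z ∧ S n z ^ 2 = (z - a) / (z - b) := by
      intro n hn z hz
      have hn' : 1 / ((n : ℝ) + 1) ≤ 1 / (N + 1) := by gcongr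
      refine hS n z (fun w hw => ?_) fun hzT =>
        hball (Metric.ball_subset_ball (by linarith) hz) hzT
      have h1 : δ ≤ dist w z₀ := by
        by_contra! h
        exact hball (Metric.mem_ball.2 h) hw
      have h2 := dist_triangle w z z₀
      rw [← dist_eq_norm, dist_comm]
      linarith [Metric.mem_ball.1 hz]
    have hcont : ∀ n ≥ N, ContinuousOn (S n) (Metric.ball z₀ (δ / 2)) := fun n hn z hz =>
      (hgood n hn z hz).1.continuousAt.continuousWithinAt
    have hnz : ∀ {z}, z ∈ Metric.ball z₀ (δ / 2) → S N z ≠ 0 := by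
      intro z hz h0
      have hzT : z ∉ T := hball (Metric.ball_subset_ball (by linarith) hz)
      have h1 := (hgood N le_rfl z hz).2
      rw [h0, zero_pow two_ne_zero] at h1
      have hne : ∀ w ∈ T, z - w ≠ 0 := fun w hw => sub_ne_zero.2 fun h => hzT (h ▸ hw)
      exact div_ne_zero (hne a ha) (hne b hbT) h1.symm
    have hsign : ∀ᶠ n in u, Set.EqOn (S n) (S N) (Metric.ball z₀ (δ / 2)) ∨
        Set.EqOn (S n) (-S N) (Metric.ball z₀ (δ / 2)) := by
      have hev : ∀ᶠ n in u, N ≤ n :=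
        (Filter.eventually_ge_atTop N).filter_mono Nat.hyperfilter_le_atTop
      filter_upwards [hev] with n hn
      refine (convex_ball z₀ (δ / 2)).isPreconnected.eq_or_eq_neg_of_sq_eq (hcont n hn)
        (hcont N le_rfl) (fun z hz => ?_) hnz
      simp only [Pi.pow_apply]
      rw [(hgood n hn z hz).2, (hgood N le_rfl z hz).2]
    have hdN : DifferentiableOn ℂ (S N) (Metric.ball z₀ (δ / 2)) := fun z hz =>
      (hgood N le_rfl z hz).1.differentiableWithinAt
    rcases Ultrafilter.eventually_or.1 hsign with hs | hs
    · exact ⟨S N, δ / 2, half_pos hδ, hdN, fun z hz =>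
        ⟨eventualValue_eq (hs.mono fun n hn => hn hz), (hgood N le_rfl z hz).2⟩⟩
    · exact ⟨-S N, δ / 2, half_pos hδ, hdN.neg, fun z hz =>
        ⟨eventualValue_eq (hs.mono fun n hn => hn hz), by
          rw [Pi.neg_apply, neg_sq]; exact (hgood N le_rfl z hz).2⟩⟩
  refine ⟨fun z => eventualValue u fun n => S n z, fun z hz => ?_, fun z hz => ?_, fun z hz => ?_⟩
  · obtain ⟨R, ρ, hρ, hR, hval⟩ := hloc z hz
    refine DifferentiableAt.differentiableWithinAt ?_
    refine ((hR z (Metric.mem_ball_self hρ)).differentiableAt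
      (Metric.ball_mem_nhds z hρ)).congr_of_eventuallyEq ?_
    filter_upwards [Metric.ball_mem_nhds z hρ] with w hw using (hval w hw).1
  · obtain ⟨R, ρ, hρ, hR, hval⟩ := hloc z hz
    have := hval z (Metric.mem_ball_self hρ)
    dsimp only
    rw [this.1, this.2]
  · refine eventualValue_eq (.of_forall fun n => ?_)
    have hz0 : z - a ≠ 0 := by
      have hr : 0 ≤ r := dist_nonneg.trans (hT ha)
      exact norm_pos_iff.1 (by linarith)
    rw [hfar n z hz, div_self hz0, Complex.log_one, zero_sub]

end SquareRoot

/-! ### Vanishing of the Cauchy transform off `Ω` -/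

section Vanishing

/-- If `S² = (z - a) / (z - b)`, the function `S / (z - a)` has absolute value
`(‖z - a‖ * ‖z - b‖) ^ (-1 / 2)`. -/
theorem sq_norm_div_sub {S z a b : ℂ} (ha : z ≠ a) (hS : S ^ 2 = (z - a) / (z - b)) :
    ‖S / (z - a)‖ ^ 2 = ‖z - a‖⁻¹ * ‖z - b‖⁻¹ := by
  have h0 : ‖z - a‖ ≠ 0 := norm_ne_zero_iff.2 (sub_ne_zero.2 ha)
  rw [norm_div, div_pow, ← norm_pow, hS, norm_div]
  field_simp

theorem inv_norm_mul_inv_norm_le {z a b : ℂ} {r : ℝ} (hr : 0 < r) (hab : dist b a = r) :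
    ‖z - a‖⁻¹ * ‖z - b‖⁻¹ ≤ r⁻¹ * (‖z - a‖⁻¹ + ‖z - b‖⁻¹) := by
  rcases eq_or_ne z a with rfl | ha
  · simp; positivity
  rcases eq_or_ne z b with rfl | hb
  · simp; positivity
  have h1 : 0 < ‖z - a‖ := norm_pos_iff.2 (sub_ne_zero.2 ha)
  have h2 : 0 < ‖z - b‖ := norm_pos_iff.2 (sub_ne_zero.2 hb)
  have h3 : r ≤ ‖z - a‖ + ‖z - b‖ := by
    have := dist_triangle b z a
    rw [hab, dist_comm b z, dist_eq_norm, dist_eq_norm] at this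
    linarith
  rw [← mul_inv, inv_add_inv h1.ne' h2.ne', inv_mul_eq_div, div_div, ← one_div,
    div_le_div_iff₀ (by positivity) (by positivity)]
  nlinarith [mul_pos h1 h2]

theorem sqrt_div_sub_mem_bergmanSpace {Ω : Set ℂ} (hopen : IsOpen Ω)
    (hbdd : Bornology.IsBounded Ω) {a b : ℂ} {r : ℝ} (hr : 0 < r) (ha : a ∉ Ω)
    (hab : dist b a = r) {S : ℂ → ℂ} (hSd : DifferentiableOn ℂ S Ω)
    (hS : ∀ z ∈ Ω, S z ^ 2 = (z - a) / (z - b)) :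
    (fun z => S z / (z - a)) ∈ bergmanSpace Ω := by
  have hne : ∀ z ∈ Ω, z ≠ a := fun z hz h => ha (h ▸ hz)
  have hd : DifferentiableOn ℂ (fun z => S z / (z - a)) Ω :=
    hSd.div (by fun_prop) fun z hz => sub_ne_zero.2 (hne z hz)
  refine ⟨hd, ?_⟩
  have hm : AEStronglyMeasurable (fun z => S z / (z - a)) (volume.restrict Ω) :=
    hd.continuousOn.aestronglyMeasurable hopen.measurableSet
  rw [memLp_two_iff_integrable_sq_norm hm]
  refine Integrable.mono' (((integrableOn_inv_norm_sub hbdd a).add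
    (integrableOn_inv_norm_sub hbdd b)).const_mul r⁻¹) (hm.norm.pow 2) ?_
  filter_upwards [ae_restrict_mem hopen.measurableSet] with z hz
  rw [sq_norm_div_sub (hne z hz) (hS z hz), Real.norm_of_nonneg (by positivity)]
  exact inv_norm_mul_inv_norm_le hr hab

/-- The distance of `S / (z - a)` to the Cauchy kernel: near `a` and `b` both are controlled by
Cauchy kernels, and far away `S` is close to `1`. -/
theorem norm_sqrt_div_sub_sub_inv_le {z a b S : ℂ} {r : ℝ} (hr : 0 < r) (hab : dist b a = r)
    (ha : z ≠ a) (hS : S ^ 2 = (z - a) / (z - b))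
    (hfar : 2 * r < ‖z - a‖ → S = Complex.exp (-Complex.log ((z - b) / (z - a)) / 2)) :
    ‖S / (z - a) - 1 / (z - a)‖ ≤ 2 * (‖z - a‖⁻¹ * min 1 (r * ‖z - a‖⁻¹)) +
      (Metric.ball a (3 * r)).indicator (fun z => 2 * ‖z - a‖⁻¹) z +
      (Metric.ball b (4 * r)).indicator (fun z => ‖z - b‖⁻¹) z := by
  have hza : 0 < ‖z - a‖ := norm_pos_iff.2 (sub_ne_zero.2 ha)
  have hind : ∀ (c : ℂ) (ρ M : ℝ), 0 ≤ M →
      0 ≤ (Metric.ball c ρ).indicator (fun z => M * ‖z - c‖⁻¹) z := fun c ρ M hM =>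
    Set.indicator_nonneg (fun _ _ => by positivity) _
  by_cases hz : z ∈ Metric.ball a (3 * r)
  · have hzb : z ∈ Metric.ball b (4 * r) := by
      rw [Metric.mem_ball] at hz ⊢
      linarith [dist_triangle z a b, dist_comm a b]
    rw [Set.indicator_of_mem hz, Set.indicator_of_mem hzb]
    have h1 : ‖S / (z - a)‖ ≤ ‖z - a‖⁻¹ + ‖z - b‖⁻¹ := by
      refine abs_le_of_sq_le_sq' ?_ (by positivity) |>.2
      rw [sq_norm_div_sub ha hS]
      have h2 : 0 ≤ ‖z - a‖⁻¹ := by positivity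
      have h3 : 0 ≤ ‖z - b‖⁻¹ := by positivity
      nlinarith [mul_nonneg h2 h3]
    have h2 : 0 ≤ 2 * (‖z - a‖⁻¹ * min 1 (r * ‖z - a‖⁻¹)) := by positivity
    have h3 := norm_sub_le (S / (z - a)) (1 / (z - a))
    have h4 : ‖1 / (z - a)‖ = ‖z - a‖⁻¹ := by rw [one_div, norm_inv]
    linarith
  · have hz3 : 3 * r ≤ ‖z - a‖ := by
      rw [← dist_eq_norm]
      simpa using hz
    have hS1 := hfar (by linarith)
    have hb1 : ‖z - b‖ ≥ 2 / 3 * ‖z - a‖ := by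
      have := dist_triangle z b a
      rw [hab, dist_eq_norm, dist_eq_norm] at this
      linarith
    have hzb : 0 < ‖z - b‖ := by linarith
    have hzb0 : z - b ≠ 0 := norm_pos_iff.1 hzb
    have hza0 : z - a ≠ 0 := norm_pos_iff.1 hza
    have hre : 0 ≤ S.re := by
      rw [hS1, Complex.exp_re]
      refine mul_nonneg (Real.exp_pos _).le (Real.cos_nonneg_of_mem_Icc ?_)
      have h1 := Complex.neg_pi_lt_arg ((z - b) / (z - a))
      have h2 := Complex.arg_le_pi ((z - b) / (z - a))
      have h3 : (-Complex.log ((z - b) / (z - a)) / 2).im = -((z - b) / (z - a)).arg / 2 := by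
        rw [show (2 : ℂ) = ((2 : ℝ) : ℂ) by norm_num, Complex.div_ofReal_im, Complex.neg_im,
          Complex.log_im]
      rw [h3]
      constructor <;> linarith
    have hS2 : 1 ≤ ‖S + 1‖ := by
      refine le_trans ?_ (Complex.re_le_norm _)
      simp only [Complex.add_re, Complex.one_re]
      linarith
    have hS3 : ‖S - 1‖ ≤ 2 * (r * ‖z - a‖⁻¹) := by
      calc ‖S - 1‖ ≤ ‖S - 1‖ * ‖S + 1‖ := le_mul_of_one_le_right (norm_nonneg _) hS2
        _ = ‖(b - a) / (z - b)‖ := by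
          rw [← norm_mul, show (S - 1) * (S + 1) = S ^ 2 - 1 by ring, hS, div_sub_one hzb0]
          congr 2
          ring
        _ = r / ‖z - b‖ := by rw [norm_div, ← dist_eq_norm, hab]
        _ ≤ r / (2 / 3 * ‖z - a‖) := by gcongr
        _ ≤ _ := by
          rw [div_eq_mul_inv, mul_inv]
          have : 0 ≤ r * ‖z - a‖⁻¹ := by positivity
          linarith
    have hmin : min 1 (r * ‖z - a‖⁻¹) = r * ‖z - a‖⁻¹ := by
      refine min_eq_right ?_
      rw [← div_eq_mul_inv, div_le_one hza]
      linarith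
    have h4 : ‖S / (z - a) - 1 / (z - a)‖ = ‖S - 1‖ * ‖z - a‖⁻¹ := by
      rw [← sub_div, norm_div, div_eq_mul_inv]
    have h5 := hind a (3 * r) 2 (by norm_num)
    have h6 : 0 ≤ (Metric.ball b (4 * r)).indicator (fun z => ‖z - b‖⁻¹) z := by
      simpa using hind b (4 * r) 1 (by norm_num)
    rw [h4, hmin]
    have h7 : ‖S - 1‖ * ‖z - a‖⁻¹ ≤ 2 * (r * ‖z - a‖⁻¹) * ‖z - a‖⁻¹ := by gcongr
    linarith

theorem tendsto_integral_min {A : Set ℂ} (hA : Bornology.IsBounded A) (a : ℂ) :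
    Filter.Tendsto (fun r : ℝ => ∫ z in A, 2 * (‖z - a‖⁻¹ * min 1 (r * ‖z - a‖⁻¹)))
      (nhdsWithin 0 (Set.Ioi 0)) (nhds 0) := by
  have h := tendsto_integral_filter_of_dominated_convergence (μ := volume.restrict A)
    (l := nhdsWithin (0 : ℝ) (Set.Ioi 0))
    (F := fun r z => 2 * (‖z - a‖⁻¹ * min 1 (r * ‖z - a‖⁻¹))) (f := fun _ => 0)
    (fun z => 2 * ‖z - a‖⁻¹) (.of_forall fun r => ?_) ?_
    ((integrableOn_inv_norm_sub hA a).const_mul 2) (.of_forall fun z => ?_)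
  · simpa using h
  · refine Measurable.aestronglyMeasurable ?_
    fun_prop
  · filter_upwards [self_mem_nhdsWithin] with r hr
    refine .of_forall fun z => ?_
    have hr : (0 : ℝ) < r := hr
    rw [Real.norm_of_nonneg (by positivity)]
    have : min 1 (r * ‖z - a‖⁻¹) ≤ 1 := min_le_left _ _
    have h0 : 0 ≤ ‖z - a‖⁻¹ := by positivity
    nlinarith
  · have hc : Continuous fun r : ℝ => 2 * (‖z - a‖⁻¹ * min 1 (r * ‖z - a‖⁻¹)) := by fun_prop
    have := (hc.tendsto 0).mono_left (nhdsWithin_le_nhds (s := Set.Ioi 0))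
    simpa using this

/-- A density orthogonal to the Bergman space has a Cauchy transform that vanishes at each point
of the complement of `Ω` that does not form a component by itself. -/
theorem cauchyTransform_eq_zero_of_orthogonal {Ω : Set ℂ} (hopen : IsOpen Ω)
    (hbdd : Bornology.IsBounded Ω) {q : ℂ → ℂ} (hq : Continuous q)
    (horth : ∀ g ∈ bergmanSpace Ω, ∫ z in Ω, q z * g z = 0) {a : ℂ}
    (ha : a ∈ Ωᶜ) (hK : (connectedComponentIn Ωᶜ a).Nontrivial) :
    cauchyTransform Ω q a = 0 := by
  obtain ⟨M, hM⟩ := hbdd.isCompact_closure.exists_bound_of_continuousOn hq.continuousOn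
  replace hM : ∀ z ∈ Ω, ‖q z‖ ≤ M := fun z hz => hM z (subset_closure hz)
  obtain ⟨c, hcK, hca⟩ := hK.exists_ne a
  have hd : 0 < dist c a := dist_pos.2 hca
  have hne : ∀ z ∈ Ω, z ≠ a := fun z hz h => ha (h ▸ hz)
  -- Test the orthogonality with `√((z - a) / (z - b)) / (z - a)`, where `b` is at distance `r`
  -- from `a`; the estimate then holds for each small `r`, and `r` tends to `0`.
  have hbound : ∀ r ∈ Set.Ioo 0 (dist c a), ‖cauchyTransform Ω q a‖ ≤
      |M| * ((∫ z in Ω, 2 * (‖z - a‖⁻¹ * min 1 (r * ‖z - a‖⁻¹))) + 20 * Real.pi * r) := by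
    rintro r ⟨hr, hrc⟩
    obtain ⟨b, hb, hba, hchain⟩ := exists_dist_eq_forall_chain hopen.isClosed_compl
      (connectedComponentIn_subset _ _) isPreconnected_connectedComponentIn
      (mem_connectedComponentIn ha) hcK hr hrc
    obtain ⟨S, hSd, hS, hfar⟩ := exists_sqrt_of_forall_chain
      (hopen.isClosed_compl.inter Metric.isClosed_closedBall) Set.inter_subset_right
      ⟨ha, Metric.mem_closedBall_self hr.le⟩ ⟨hb, hba.le⟩ hchain
    have hsub : Ω ⊆ (Ωᶜ ∩ Metric.closedBall a r)ᶜ := fun z hz h => h.1 hz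
    have hg := sqrt_div_sub_mem_bergmanSpace hopen hbdd hr ha hba (hSd.mono hsub)
      fun z hz => hS z (hsub hz)
    have hfin : IsFiniteMeasure (volume.restrict Ω) := ⟨by
      rw [Measure.restrict_apply_univ]; exact hbdd.measure_lt_top⟩
    have hgL : MemLp (fun z => S z / (z - a)) 2 (volume.restrict Ω) := hg.2
    have hgi : Integrable (fun z => q z * (S z / (z - a))) (volume.restrict Ω) := by
      refine (hgL.integrable one_le_two).bdd_mul (c := M) hq.aestronglyMeasurable ?_
      filter_upwards [ae_restrict_mem hopen.measurableSet] with z hz using hM z hz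
    have heq : cauchyTransform Ω q a = -∫ z in Ω, q z * (S z / (z - a) - 1 / (z - a)) := by
      have h1 := horth _ hg
      have h2 := integral_sub hgi (integrableOn_div_sub hbdd hopen.measurableSet hq a)
      rw [h1, zero_sub] at h2
      rw [← neg_eq_iff_eq_neg, cauchyTransform, ← h2]
      congr 1
      ext z
      ring
    set B : ℂ → ℝ := fun z => 2 * (‖z - a‖⁻¹ * min 1 (r * ‖z - a‖⁻¹)) with hB
    have hBi : IntegrableOn B Ω := by
      refine Integrable.mono' ((integrableOn_inv_norm_sub hbdd a).const_mul 2)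
        (Measurable.aestronglyMeasurable (by fun_prop)) (.of_forall fun z => ?_)
      rw [Real.norm_of_nonneg (by positivity)]
      have : min 1 (r * ‖z - a‖⁻¹) ≤ 1 := min_le_left _ _
      have h0 : 0 ≤ ‖z - a‖⁻¹ := by positivity
      nlinarith
    have hI₁ : Integrable ((Metric.ball a (3 * r)).indicator (fun z => 2 * ‖z - a‖⁻¹)) :=
      (integrable_indicator_iff Metric.isOpen_ball.measurableSet).2
        ((integrableOn_ball_inv_norm_sub a _).const_mul 2)
    have hI₂ : Integrable ((Metric.ball b (4 * r)).indicator (fun z => ‖z - b‖⁻¹)) :=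
      (integrable_indicator_iff Metric.isOpen_ball.measurableSet).2
        (integrableOn_ball_inv_norm_sub b _)
    have hJ₁ : ∫ z in Ω, (Metric.ball a (3 * r)).indicator (fun z => 2 * ‖z - a‖⁻¹) z ≤
        12 * Real.pi * r := by
      refine (setIntegral_le_integral hI₁ (.of_forall fun z =>
        Set.indicator_nonneg (fun _ _ => by positivity) _)).trans (le_of_eq ?_)
      rw [integral_indicator Metric.isOpen_ball.measurableSet, integral_const_mul,
        setIntegral_ball_inv_norm_sub _ (by positivity)]
      ring
    have hJ₂ : ∫ z in Ω, (Metric.ball b (4 * r)).indicator (fun z => ‖z - b‖⁻¹) z ≤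
        8 * Real.pi * r := by
      refine (setIntegral_le_integral hI₂ (.of_forall fun z =>
        Set.indicator_nonneg (fun _ _ => by positivity) _)).trans (le_of_eq ?_)
      rw [integral_indicator Metric.isOpen_ball.measurableSet,
        setIntegral_ball_inv_norm_sub _ (by positivity)]
      ring
    rw [heq, norm_neg]
    calc ‖∫ z in Ω, q z * (S z / (z - a) - 1 / (z - a))‖
        ≤ ∫ z in Ω, |M| * (B z + (Metric.ball a (3 * r)).indicator (fun z => 2 * ‖z - a‖⁻¹) z +
          (Metric.ball b (4 * r)).indicator (fun z => ‖z - b‖⁻¹) z) := by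
          refine norm_integral_le_of_norm_le
            (((hBi.add hI₁.integrableOn).add hI₂.integrableOn).const_mul _) ?_
          filter_upwards [ae_restrict_mem hopen.measurableSet] with z hz
          rw [norm_mul]
          exact mul_le_mul ((hM z hz).trans (le_abs_self M))
            (norm_sqrt_div_sub_sub_inv_le hr hba (hne z hz) (hS z (hsub hz)) (hfar z))
            (norm_nonneg _) (abs_nonneg _)
      _ = |M| * ((∫ z in Ω, B z) +
          (∫ z in Ω, (Metric.ball a (3 * r)).indicator (fun z => 2 * ‖z - a‖⁻¹) z) +
          ∫ z in Ω, (Metric.ball b (4 * r)).indicator (fun z => ‖z - b‖⁻¹) z) := by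
          have e₁ := integral_add hBi (hI₁.integrableOn (s := Ω))
          have e₂ := integral_add (hBi.add (hI₁.integrableOn (s := Ω)))
            (hI₂.integrableOn (s := Ω))
          rw [integral_const_mul, ← e₁]
          congr 1
      _ ≤ _ := by
          refine mul_le_mul_of_nonneg_left ?_ (abs_nonneg M)
          rw [add_assoc]
          refine add_le_add le_rfl ?_
          linarith
  have hlim : Filter.Tendsto (fun r : ℝ =>
      |M| * ((∫ z in Ω, 2 * (‖z - a‖⁻¹ * min 1 (r * ‖z - a‖⁻¹))) + 20 * Real.pi * r))
      (nhdsWithin 0 (Set.Ioi 0)) (nhds 0) := by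
    have h1 : Filter.Tendsto (fun r : ℝ => 20 * Real.pi * r) (nhdsWithin 0 (Set.Ioi 0))
        (nhds 0) := by
      have hc : Continuous fun r : ℝ => 20 * Real.pi * r := by fun_prop
      simpa using (hc.tendsto 0).mono_left (nhdsWithin_le_nhds (s := Set.Ioi 0))
    simpa using ((tendsto_integral_min hbdd a).add h1).const_mul |M|
  refine norm_le_zero_iff.1 (ge_of_tendsto hlim ?_)
  filter_upwards [Ioo_mem_nhdsGT hd] with r hr using hbound r hr

end Vanishing

/-! ### Maximum principles -/

section MaximumPrinciple

/-- A function holomorphic on a bounded domain and continuous up to the boundary is constant if its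
boundary values are real. -/
theorem exists_eq_real_of_im_eq_zero_on_frontier {Ω : Set ℂ} (hopen : IsOpen Ω)
    (hconn : IsConnected Ω) (hbdd : Bornology.IsBounded Ω) {G : ℂ → ℂ} (hGc : Continuous G)
    (hGd : DifferentiableOn ℂ G Ω) (hG : ∀ z ∈ frontier Ω, (G z).im = 0) :
    ∃ c : ℝ, ∀ z ∈ closure Ω, G z = c := by
  -- the maximum principle for `exp (σ * I * G)`, of absolute value `exp (-σ * Im G)`
  have hsign : ∀ σ : ℝ, ∀ z ∈ closure Ω, 0 ≤ σ * (G z).im := by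
    intro σ z hz
    have hnorm : ∀ z, ‖Complex.exp (σ * Complex.I * G z)‖ = Real.exp (-(σ * (G z).im)) := by
      intro z
      rw [Complex.norm_exp]
      simp
    have hd : DiffContOnCl ℂ (fun z => Complex.exp (σ * Complex.I * G z)) Ω :=
      ⟨(hGd.const_mul _).cexp, by fun_prop⟩
    have h := Complex.norm_le_of_forall_mem_frontier_norm_le hbdd hd (C := 1)
      (fun z hz => by rw [hnorm, hG z hz]; simp) hz
    rw [hnorm, Real.exp_le_one_iff] at h
    linarith
  have him : ∀ z ∈ closure Ω, (G z).im = 0 := fun z hz =>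
    le_antisymm (by linarith [hsign (-1) z hz]) (by linarith [hsign 1 z hz])
  obtain ⟨z₀, hz₀⟩ := hconn.nonempty
  refine ⟨(G z₀).re, fun z hz => ?_⟩
  have hconst : Set.EqOn (fun z => Complex.exp (Complex.I * G z))
      (Function.const ℂ (Complex.exp (Complex.I * G z₀))) Ω := by
    refine Complex.eqOn_of_isPreconnected_of_isMaxOn_norm hconn.isPreconnected hopen
      (hGd.const_mul _).cexp hz₀ fun w hw => ?_
    simp only [Function.comp_apply, Set.mem_ofPred_eq, Complex.norm_exp]
    simp [him w (subset_closure hw), him z₀ (subset_closure hz₀)]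
  have hderiv : Set.EqOn (deriv G) 0 Ω := by
    intro w hw
    have hGw : HasDerivAt G (deriv G w) w :=
      (hGd.differentiableAt (hopen.mem_nhds hw)).hasDerivAt
    have h1 := (hGw.const_mul Complex.I).cexp
    have h2 : (fun z => Complex.exp (Complex.I * G z)) =ᶠ[nhds w]
        fun _ => Complex.exp (Complex.I * G z₀) := by
      filter_upwards [hopen.mem_nhds hw] with z hz using hconst hz
    have h3 := h1.unique ((hasDerivAt_const w _).congr_of_eventuallyEq h2)
    simpa using h3
  have hΩ : ∀ w ∈ Ω, G w = G z₀ := fun w hw =>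
    hopen.is_const_of_deriv_eq_zero hconn.isPreconnected hGd hderiv hw hz₀
  have hcl : closure Ω ⊆ {w | G w = G z₀} :=
    closure_minimal hΩ (isClosed_eq hGc continuous_const)
  rw [show G z = G z₀ from hcl hz]
  exact Complex.ext rfl (him z₀ (subset_closure hz₀))

/-- The function `|z|² - 2 Re P(z) - c`, with Laplacian `4`. -/
noncomputable def quadraticPotential (P : ℂ[X]) (c : ℝ) (z : ℂ) : ℝ :=
  ‖z‖ ^ 2 - 2 * (P.eval z).re - c

variable (P : ℂ[X]) (c : ℝ)

theorem continuous_quadraticPotential : Continuous (quadraticPotential P c) := by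
  unfold quadraticPotential
  fun_prop

/-- The function is strictly subharmonic: it is `|z - z₀|²` plus the real part of a polynomial. -/
theorem not_isLocalMax_quadraticPotential (z₀ : ℂ) :
    ¬IsLocalMax (quadraticPotential P c) z₀ := by
  intro hmax
  set w := quadraticPotential P c with hw
  let h : ℂ → ℂ := fun z => 2 * conj z₀ * z - 2 * P.eval z - ((‖z₀‖ ^ 2 + c : ℝ) : ℂ)
  have hre : ∀ z, (h z).re = w z - ‖z - z₀‖ ^ 2 := by
    intro z
    simp only [h, hw, quadraticPotential, ← Complex.normSq_eq_norm_sq, Complex.normSq_apply]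
    simp
    ring
  obtain ⟨s, hs, hball⟩ := Metric.eventually_nhds_iff_ball.1 hmax
  have hd : Differentiable ℂ fun z => Complex.exp (h z) := by
    simp only [h]
    fun_prop
  have hmod := Complex.norm_le_of_forall_mem_frontier_norm_le
    (Metric.isBounded_ball (x := z₀) (r := s / 2)) hd.diffContOnCl
    (C := Real.exp (w z₀ - (s / 2) ^ 2)) (fun z hz => ?_)
    (subset_closure (Metric.mem_ball_self (half_pos hs)))
  · rw [Complex.norm_exp, hre, Real.exp_le_exp, sub_self, norm_zero] at hmod
    have : 0 < (s / 2) ^ 2 := by positivity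
    linarith
  · rw [frontier_ball _ (half_pos hs).ne', mem_sphere_iff_norm] at hz
    rw [Complex.norm_exp, hre, Real.exp_le_exp, hz]
    have := hball z (by rw [Metric.mem_ball, dist_eq_norm]; linarith)
    linarith

theorem quadraticPotential_neg {V : Set ℂ} (hV : IsOpen V) (hVb : Bornology.IsBounded V)
    (hfr : ∀ z ∈ frontier V, quadraticPotential P c z ≤ 0) :
    ∀ z ∈ V, quadraticPotential P c z < 0 := by
  intro z hz
  obtain ⟨z₁, hz₁, hmax⟩ := hVb.isCompact_closure.exists_isMaxOn ⟨z, subset_closure hz⟩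
    (continuous_quadraticPotential P c).continuousOn
  have hz₁fr : z₁ ∈ frontier V := by
    refine ⟨hz₁, fun hint => not_isLocalMax_quadraticPotential P c z₁ ?_⟩
    filter_upwards [mem_interior_iff_mem_nhds.1 hint] with w hw using hmax (subset_closure hw)
  have hle : ∀ w ∈ V, quadraticPotential P c w ≤ 0 := fun w hw =>
    le_trans (hmax (subset_closure hw)) (hfr z₁ hz₁fr)
  refine lt_of_le_of_ne (hle z hz) fun h0 => not_isLocalMax_quadraticPotential P c z ?_
  filter_upwards [hV.mem_nhds hz] with w hw
  rw [h0]
  exact hle w hw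

/-- A bounded open set on whose boundary `|z|² - 2 Re P` is constant has no holes. -/
theorem subset_of_frontier_subset {Ω : Set ℂ} (hopen : IsOpen Ω) (hbdd : Bornology.IsBounded Ω)
    (hΩ : ∀ z ∈ frontier Ω, quadraticPotential P c z = 0) {V : Set ℂ} (hV : IsOpen V)
    (hVb : Bornology.IsBounded V) (hVΩ : frontier V ⊆ Ω) : V ⊆ Ω := by
  have hneg := quadraticPotential_neg P c hopen hbdd fun z hz => (hΩ z hz).le
  have hVneg := quadraticPotential_neg P c hV hVb fun z hz => (hneg z (hVΩ hz)).le
  have hD : V \ Ω = V \ closure Ω := by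
    refine subset_antisymm (fun z hz => ⟨hz.1, fun hcl => ?_⟩)
      (Set.sdiff_subset_sdiff_right subset_closure)
    have hfr : z ∈ frontier Ω := ⟨hcl, fun h => hz.2 (interior_subset h)⟩
    exact (hVneg z hz.1).ne (hΩ z hfr)
  have hDo : IsOpen (V \ Ω) := hD ▸ hV.sdiff isClosed_closure
  have hDc : IsClosed (V \ Ω) := by
    refine isClosed_of_closure_subset fun z hz => ?_
    have hzΩ : z ∉ Ω := by
      have : closure (V \ Ω) ⊆ Ωᶜ := closure_minimal (fun z hz => hz.2) hopen.isClosed_compl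
      exact this hz
    refine ⟨by_contra fun hzV => hzΩ (hVΩ ⟨closure_mono Set.sdiff_subset hz, fun h => ?_⟩), hzΩ⟩
    exact hzV (interior_subset h)
  rcases isClopen_iff.1 ⟨hDc, hDo⟩ with h | h
  · exact Set.sdiff_eq_empty.1 h
  · exact absurd (hVb.subset (h ▸ Set.sdiff_subset)) (NormedSpace.unbounded_univ ℂ ℂ)

/-- Real and imaginary part of a complex polynomial are real polynomials in two variables. -/
theorem exists_mvPolynomial_re_im : ∃ A B : MvPolynomial (Fin 2) ℝ, ∀ z : ℂ,
    MvPolynomial.eval ![z.re, z.im] A = (P.eval z).re ∧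
      MvPolynomial.eval ![z.re, z.im] B = (P.eval z).im := by
  induction P using Polynomial.induction_on with
  | C a => exact ⟨MvPolynomial.C a.re, MvPolynomial.C a.im, fun z => by simp⟩
  | add P Q hP hQ =>
    obtain ⟨A, B, h⟩ := hP
    obtain ⟨A', B', h'⟩ := hQ
    exact ⟨A + A', B + B', fun z => by simp [h z, h' z]⟩
  | monomial n a h =>
    obtain ⟨A, B, h⟩ := h
    refine ⟨A * MvPolynomial.X 0 - B * MvPolynomial.X 1, A * MvPolynomial.X 1 +
      B * MvPolynomial.X 0, fun z => ?_⟩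
    have e : (C a * X ^ (n + 1)).eval z = (C a * X ^ n).eval z * z := by simp; ring
    rw [e, Complex.mul_re, Complex.mul_im, ← (h z).1, ← (h z).2]
    simp

theorem isAlgebraicPlaneSet_of_quadraticPotential_eq_zero {S : Set ℂ}
    (hS : ∀ z ∈ S, quadraticPotential P c z = 0) : IsAlgebraicPlaneSet S := by
  obtain ⟨A, B, hA⟩ := exists_mvPolynomial_re_im P
  have heval : ∀ z : ℂ, MvPolynomial.eval ![z.re, z.im] (MvPolynomial.X 0 ^ 2 +
      MvPolynomial.X 1 ^ 2 - 2 * A - MvPolynomial.C c) = quadraticPotential P c z := by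
    intro z
    rw [quadraticPotential, ← (hA z).1, ← Complex.normSq_eq_norm_sq, Complex.normSq_apply]
    simp
    ring
  refine ⟨_, fun h0 => not_isLocalMax_quadraticPotential P c 0 ?_,
    fun z hz => (heval z).trans (hS z hz)⟩
  rw [h0] at heval
  exact .of_forall fun z => by simp [← heval]

end MaximumPrinciple

/-! ### The boundary curve -/

section BoundaryCurve

/-- Every complex polynomial has a primitive. -/
theorem exists_derivative_eq (p : ℂ[X]) : ∃ P : ℂ[X], derivative P = p := by
  induction p using Polynomial.induction_on' with
  | add p q hp hq =>
    obtain ⟨P, rfl⟩ := hp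
    obtain ⟨Q, rfl⟩ := hq
    exact ⟨P + Q, by simp⟩
  | monomial n a =>
    refine ⟨monomial (n + 1) (a / (n + 1)), ?_⟩
    have : (n : ℂ) + 1 ≠ 0 := by exact_mod_cast n.succ_ne_zero
    rw [derivative_monomial]
    simp [this]

/-- If `z - conj (P' z)` is orthogonal to the Bergman space and no point of the boundary is a
component of the complement, the boundary lies on a curve `|z|² - 2 Re P = c`. -/
theorem exists_quadraticPotential_eq_zero_on_frontier {Ω : Set ℂ} (hopen : IsOpen Ω)
    (hconn : IsConnected Ω) (hbdd : Bornology.IsBounded Ω)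
    (hnondeg : ∀ a ∈ Ωᶜ, (connectedComponentIn Ωᶜ a).Nontrivial) (P : ℂ[X])
    (horth : ∀ g ∈ bergmanSpace Ω, ∫ z in Ω, (z - conj ((derivative P).eval z)) * g z = 0) :
    ∃ c : ℝ, ∀ z ∈ frontier Ω, quadraticPotential P c z = 0 := by
  set q : ℂ → ℂ := fun z => z - conj ((derivative P).eval z) with hq
  have hqc : Continuous q := by fun_prop
  have hφ := continuous_cauchyTransform hbdd hopen.measurableSet hqc
  set G : ℂ → ℂ := fun ζ => cauchyTransform Ω q ζ / Real.pi + ζ * conj ζ - conj (P.eval ζ) -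
    P.eval ζ with hG
  have hfr : ∀ z ∈ frontier Ω, z ∉ Ω := fun z hz hzΩ => hz.2 (hopen.interior_eq.symm ▸ hzΩ)
  have hGfr : ∀ z ∈ frontier Ω, G z = ((‖z‖ ^ 2 - 2 * (P.eval z).re : ℝ) : ℂ) := by
    intro z hz
    simp only [hG]
    rw [cauchyTransform_eq_zero_of_orthogonal hopen hbdd hqc horth (hfr z hz)
      (hnondeg z (hfr z hz)), Complex.mul_conj, Complex.normSq_eq_norm_sq, sub_sub,
      add_comm (conj _), Complex.add_conj]
    push_cast
    ring
  obtain ⟨c, hc⟩ := exists_eq_real_of_im_eq_zero_on_frontier hopen hconn hbdd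
    (G := G) (by fun_prop)
    ((differentiableOn_cauchyTransform_add hopen hbdd P).sub (by fun_prop))
    fun z hz => by rw [hGfr z hz, Complex.ofReal_im]
  refine ⟨c, fun z hz => ?_⟩
  have h := (hGfr z hz).symm.trans (hc z (frontier_subset_closure hz))
  rw [quadraticPotential, sub_eq_zero]
  exact_mod_cast h

end BoundaryCurve

theorem corollary2p4 (Ω : Set ℂ)
    (hopen : IsOpen Ω) (hconn : IsConnected Ω) (hbdd : Bornology.IsBounded Ω)
    (hfin : (complementComponents Ω).Finite)
    (hnondeg : ∀ K ∈ complementComponents Ω, K.Nontrivial)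
    (f : ℂ → ℂ) (hf : IsBestBergmanApprox Ω (fun z => conj z) f)
    (p : ℂ[X]) (hp : ∀ z ∈ Ω, f z = p.eval z) :
    IsSimplyConnected Ω ∧ IsAlgebraicPlaneSet (frontier Ω) := by
  obtain ⟨P, rfl⟩ := exists_derivative_eq p
  obtain ⟨c, hc⟩ := exists_quadraticPotential_eq_zero_on_frontier hopen hconn hbdd
    (fun a ha => hnondeg _ ⟨a, ha, rfl⟩) P fun g hg => by
      rw [← hf.integral_eq_zero (memLp_conj hopen.measurableSet hbdd) hg]
      refine setIntegral_congr_fun hopen.measurableSet fun z hz => ?_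
      simp only [hp z hz, map_sub, Complex.conj_conj]
  exact ⟨isSimplyConnected_of_frontier_subset hopen hconn fun V hV hVb hVΩ =>
    subset_of_frontier_subset P c hopen hbdd hc hV hVb hVΩ,
    isAlgebraicPlaneSet_of_quadraticPotential_eq_zero P c hc⟩
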